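/- **Conventions.** Let $\sigma_1,\sigma_2,\sigma_3$ be the right-invariant 1-forms on $SU(2)$ with $d\sigma_i=-\tfrac12\epsilon_{ijk}\sigma_j\wedge\sigma_k$, and $L_i$ the dual right-invariant vector fields; $SU(2)$ acts by right translations (generated by left-invariant fields). Let $\ell>0$. A *timelike supersymmetric solution* of $D=5$ minimal gauged supergravity on $\mathbb R_t\times B$, $\dim B=4$, with supersymmetric Killing field $V=\partial_t$, is a pair $(g,F)$ with $$g=-f^2(dt+\omega)^2+f^{-1}h,\qquad F=\tfrac{\sqrt3}{2}\,d\big(f(dt+\omega)\big)-\tfrac1{\sqrt3}G^+-\tfrac{\sqrt3}{\ell f}J,$$ where $f>0$ is a smooth function and $\omega$ a smooth 1-form on $B$, $(B,h,J)$ is Kähler with Kähler form $J$, oriented by $\mathrm{vol}_B=-\tfrac12J\wedge J$, $G^\pm=\tfrac12f(d\omega\pm\star_Bd\omega)$, and, with $R$, $R_{ab}$, $\mathcal R_{ab}=\tfrac12R_{ab}{}^{cd}J_{cd}$ the scalar curvature, the Ricci tensor and the Ricci form of $h$, $$f^{-1}=-\tfrac{\ell^2}{24}R,\qquad G^+=-\tfrac{\ell}{2}\big(\mathcal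 R-\tfrac14RJ\big),\qquad \tfrac14G^-_{ab}J^{ab}=\tfrac{\ell}{2R}\Big(\tfrac12\nabla^2R+\tfrac23R_{ab}R^{ab}-\tfrac13R^2\Big).$$ **Hypotheses.** Let $\lambda_-<0<\lambda_+$, and let $\Delta,h_i,\gamma_{ij}$ ($i,j=1,2,3$) be smooth functions of $\lambda\in(\lambda_-,\lambda_+)$ with $(\gamma_{ij})$ symmetric positive definite and $\Delta>0$ for $\lambda>0$. On $\mathbb R_v\times(\lambda_-,\lambda_+)\times SU(2)$ consider the metric with smooth horizon $\lambda=0$ in Gaussian null coordinates $$g=-\lambda^2\Delta^2dv^2+2\,dv\,d\lambda+2\lambda h_i\sigma_i\,dv+\gamma_{ij}\sigma_i\sigma_j .$$ Suppose that on $\{0<\lambda<\lambda_+\}$ the metric $g$, together with an $SU(2)$-invariant Maxwell field $F$, is a timelike supersymmetric solution with $V=\partial_v$, $t=v$ and data $(f,\omega,h,J)$ on $B=(0,\lambda_+)\times SU(2)$. Denote values at $\lambda=0$ by $\mathring\Delta,\mathring h_i,\mathring\gamma_{ij}$, and put $\mathring h^i=(\mathring\gamma^{-1})_{ij}\mathring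 h_j$. Suppose that $\mathring\Delta>0$ and that the near-horizon geometry (the metric above with $\Delta,h_i,\gamma_{ij}$ replaced by $\mathring\Delta,\mathring h_i,\mathring\gamma_{ij}$) is $U(1)\times SU(2)$-invariant, $U(1)$ being the group of left translations generated by $L_3$. **Conclusion.** There are an interval $(0,\rho_0)$, $0<\rho_0\le\infty$, and an $SU(2)$-equivariant diffeomorphism $\Psi:(0,\lambda_+)\times SU(2)\to(0,\rho_0)\times SU(2)$, under which $\rho$ is a function of $\lambda$ alone with $\rho\to0$ as $\lambda\to0^+$ (so the horizon is at $\rho=0$), and smooth $h_{ij}(\rho)$ (positive definite), $\omega_i(\rho)$, $\chi(\lambda)$, and a function $f(\rho)$, such that $$h=\Psi^*\big(d\rho^2+h_{ij}(\rho)\sigma_i\sigma_j\big),\qquad \omega=\Psi^*\big(\omega_i(\rho)\sigma_i\big)+d\chi(\lambda),\qquad f=\Psi^*f(\rho),$$ and the horizon is a conical singularity of the Kähler base: as $\rho\to0^+$, $$h_{ij}=\rho^2\mathring h_{ij}+O(\rho^4),\qquad \omega_i=\frac{\mathring\omega_i}{\rho^2}+O(1),\qquad f=\rho^2\mathring f+O(\rho^4),$$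 where near $\rho=0$ the subleading term of $f$ is a smooth function of $\rho^2$. The constants are determined by the near-horizon geometry, $$\mathring h_{ij}=\tfrac14(\mathring\Delta^2+\mathring h_k\mathring h^k)\Big(\mathring\gamma_{ij}+\frac{\mathring h_i\mathring h_j}{\mathring\Delta^2}\Big),\quad \mathring\omega_i=-\frac{4\mathring h_i}{\mathring\Delta(\mathring\Delta^2+\mathring h_k\mathring h^k)},\quad \mathring f=\tfrac14(\mathring\Delta^2+\mathring h_k\mathring h^k),$$ and $(\mathring h_{ij})$ is positive definite and diagonal with $\mathring h_{11}=\mathring h_{22}$, $\mathring\omega_i=\mathring\omega_3\delta_{i3}$, and $\mathring f>0$. -/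

import Mathlib

open Set Filter Topology Asymptotics
open scoped Quaternion ContDiff Matrix

namespace Sugra

/-! ## The cylinder `ℝ × SU(2)` and its right-invariant coframe

`SU(2)` is the group of unit quaternions, and `ℝ × SU(2)` is identified with `ℍ \ {0}` by
`(s, u) ↦ exp s • u`, so that the coordinate `s` is `log ‖x‖`. The Maurer-Cartan form `dx x⁻¹` is
`ds + du u⁻¹`. A tangent vector at `x` is an element of `ℍ`. -/

/-- The part `I × SU(2)` of the cylinder `ℝ × SU(2) = ℍ \ {0}`. -/
def cyl (I : Set ℝ) : Set ℍ[ℝ] := {x | x ≠ 0 ∧ Real.log ‖x‖ ∈ I}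

/-- The 1-form `ds`, for `s = log ‖x‖`, at the point `x`. -/
noncomputable def ds (x X : ℍ[ℝ]) : ℝ := (X * x⁻¹).re

/-- The right-invariant 1-forms `σ₁, σ₂, σ₃` of `SU(2)` at the point `x`, normalised by
`dσᵢ = - ½ εᵢⱼₖ σⱼ ∧ σₖ` (that is, `σ = - 2 Im (du u⁻¹)`). They are invariant under right
translations `x ↦ x q` and are rotated by left translations. -/
noncomputable def sigma (i : Fin 3) (x X : ℍ[ℝ]) : ℝ :=
  -2 * ![(X * x⁻¹).imI, (X * x⁻¹).imJ, (X * x⁻¹).imK] i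

/-! ## Tensor calculus in the global coordinates of `ℍ = ℝ⁴` -/

/-- The coordinate basis of `ℍ = ℝ⁴`. -/
def e : Fin 4 → ℍ[ℝ] := ![⟨1, 0, 0, 0⟩, ⟨0, 1, 0, 0⟩, ⟨0, 0, 1, 0⟩, ⟨0, 0, 0, 1⟩]

/-- The coordinates of `X` in the basis `e`. -/
def coord (X : ℍ[ℝ]) : Fin 4 → ℝ := ![X.re, X.imI, X.imJ, X.imK]

/-- Covariant 2-tensor fields on (open subsets of) `E`. -/
abbrev Tensor2 (E : Type*) [NormedAddCommGroup E] [NormedSpace ℝ E] : Type _ :=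
  E → (E →L[ℝ] E →L[ℝ] ℝ)

/-- 1-forms on (open subsets of) `E`. -/
abbrev OneForm (E : Type*) [NormedAddCommGroup E] [NormedSpace ℝ E] : Type _ :=
  E → (E →L[ℝ] ℝ)

/-- The exterior derivative of a 1-form, `dα(X, Y) = X(α(Y)) - Y(α(X))` for constant `X, Y`. -/
noncomputable def extd {E : Type*} [NormedAddCommGroup E] [NormedSpace ℝ E]
    (α : OneForm E) (p X Y : E) : ℝ :=
  fderiv ℝ α p X Y - fderiv ℝ α p Y X

/-- The coordinate partial derivative `∂ₐ φ`. -/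
noncomputable def pd (a : Fin 4) (φ : ℍ[ℝ] → ℝ) (x : ℍ[ℝ]) : ℝ := fderiv ℝ φ x (e a)

/-- The components `T_{ab}`. -/
noncomputable def comp (T : Tensor2 ℍ[ℝ]) (x : ℍ[ℝ]) : Matrix (Fin 4) (Fin 4) ℝ :=
  Matrix.of fun a b => T x (e a) (e b)

/-- The inverse metric `h^{ab}`. -/
noncomputable def inv (h : Tensor2 ℍ[ℝ]) (x : ℍ[ℝ]) : Matrix (Fin 4) (Fin 4) ℝ := (comp h x)⁻¹

/-- The Christoffel symbols `Γ^a_{bc}`. -/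
noncomputable def christoffel (h : Tensor2 ℍ[ℝ]) (a b c : Fin 4) (x : ℍ[ℝ]) : ℝ :=
  (1 / 2) * ∑ d, inv h x a d *
    (pd b (fun y => comp h y d c) x + pd c (fun y => comp h y d b) x
      - pd d (fun y => comp h y b c) x)

/-- The Riemann tensor `R^a_{bcd}` (positive sectional curvature on round spheres). -/
noncomputable def riem (h : Tensor2 ℍ[ℝ]) (x : ℍ[ℝ]) (a b c d : Fin 4) : ℝ :=
  pd c (christoffel h a d b) x - pd d (christoffel h a c b) x
    + ∑ k, (christoffel h a c k x * christoffel h k d b x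
      - christoffel h a d k x * christoffel h k c b x)

/-- The Riemann tensor `R_{abcd}`. -/
noncomputable def riemLow (h : Tensor2 ℍ[ℝ]) (x : ℍ[ℝ]) (a b c d : Fin 4) : ℝ :=
  ∑ k, comp h x a k * riem h x k b c d

/-- The Ricci tensor `R_{bd} = R^a_{bad}`. -/
noncomputable def ricci (h : Tensor2 ℍ[ℝ]) (x : ℍ[ℝ]) (b d : Fin 4) : ℝ :=
  ∑ a, riem h x a b a d

/-- The scalar curvature. -/
noncomputable def scalar (h : Tensor2 ℍ[ℝ]) (x : ℍ[ℝ]) : ℝ :=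
  ∑ b, ∑ d, inv h x b d * ricci h x b d

/-- `R_{ab} R^{ab}`. -/
noncomputable def ricciSq (h : Tensor2 ℍ[ℝ]) (x : ℍ[ℝ]) : ℝ :=
  ∑ a, ∑ b, ∑ c, ∑ d, inv h x a c * inv h x b d * ricci h x a b * ricci h x c d

/-- The Laplacian `∇² φ = h^{ab} ∇ₐ ∇_b φ`. -/
noncomputable def laplacian (h : Tensor2 ℍ[ℝ]) (φ : ℍ[ℝ] → ℝ) (x : ℍ[ℝ]) : ℝ :=
  ∑ a, ∑ b, inv h x a b * (pd a (pd b φ) x - ∑ c, christoffel h c a b x * pd c φ x)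

/-- Indices raised: `α^{ab} = h^{ac} h^{bd} α_{cd}`. -/
noncomputable def raise (h : Tensor2 ℍ[ℝ]) (α : Fin 4 → Fin 4 → ℝ) (x : ℍ[ℝ]) (a b : Fin 4) : ℝ :=
  ∑ c, ∑ d, inv h x a c * inv h x b d * α c d

/-- `J` is the Kähler form of a Kähler structure with metric `h` on the open set `U`:
`h` is a Riemannian metric, `J` is a 2-form, `J^a_c J^c_b = - δ^a_b` and `∇ J = 0`. -/
structure IsKahler (U : Set ℍ[ℝ]) (h J : Tensor2 ℍ[ℝ]) : Prop where
  smooth_metric : ContDiffOn ℝ ∞ h U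
  smooth_form : ContDiffOn ℝ ∞ J U
  symm : ∀ x ∈ U, ∀ X Y, h x X Y = h x Y X
  pos : ∀ x ∈ U, ∀ X, X ≠ 0 → 0 < h x X X
  alt : ∀ x ∈ U, ∀ X Y, J x X Y = - J x Y X
  almostComplex : ∀ x ∈ U, (inv h x * comp J x) * (inv h x * comp J x) = -1
  parallel : ∀ x ∈ U, ∀ a b c,
    pd c (fun y => comp J y a b) x
      - ∑ d, (christoffel h d c a x * comp J x d b + christoffel h d c b x * comp J x a d) = 0

/-- The Ricci form `ℛ_{ab} = ½ R_{ab}^{cd} J_{cd}`. -/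
noncomputable def ricciForm (h J : Tensor2 ℍ[ℝ]) (x : ℍ[ℝ]) (a b : Fin 4) : ℝ :=
  (1 / 2) * ∑ c, ∑ d, riemLow h x a b c d * raise h (comp J x) x c d

/-- The volume form for which `J` is anti-self-dual, `vol = - ½ J ∧ J`. -/
noncomputable def vol (J : Tensor2 ℍ[ℝ]) (x : ℍ[ℝ]) (a b c d : Fin 4) : ℝ :=
  -(comp J x a b * comp J x c d - comp J x a c * comp J x b d + comp J x a d * comp J x b c)

/-- The Hodge star of a 2-form, with respect to `h` and the volume form `- ½ J ∧ J`. -/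
noncomputable def hodge (h J : Tensor2 ℍ[ℝ]) (α : Fin 4 → Fin 4 → ℝ) (x : ℍ[ℝ])
    (a b : Fin 4) : ℝ :=
  (1 / 2) * ∑ c, ∑ d, vol J x a b c d * raise h α x c d

/-- `G⁺ = ½ f (dω + ⋆ dω)`. -/
noncomputable def Gplus (f : ℍ[ℝ] → ℝ) (om : OneForm ℍ[ℝ]) (h J : Tensor2 ℍ[ℝ]) (x : ℍ[ℝ])
    (a b : Fin 4) : ℝ :=
  (1 / 2) * f x * (extd om x (e a) (e b) + hodge h J (fun c d => extd om x (e c) (e d)) x a b)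

/-- `G⁻ = ½ f (dω - ⋆ dω)`. -/
noncomputable def Gminus (f : ℍ[ℝ] → ℝ) (om : OneForm ℍ[ℝ]) (h J : Tensor2 ℍ[ℝ]) (x : ℍ[ℝ])
    (a b : Fin 4) : ℝ :=
  (1 / 2) * f x * (extd om x (e a) (e b) - hodge h J (fun c d => extd om x (e c) (e d)) x a b)

/-! ## Timelike supersymmetric solutions -/

/-- The 1-form `f (dt + om)` on `ℝ × B`. -/
noncomputable def timeForm (f : ℍ[ℝ] → ℝ) (om : OneForm ℍ[ℝ]) : OneForm (ℝ × ℍ[ℝ]) := fun p =>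
  f p.2 • (ContinuousLinearMap.fst ℝ ℝ ℍ[ℝ] + (om p.2).comp (ContinuousLinearMap.snd ℝ ℝ ℍ[ℝ]))

/-- The field `(g, F)` on `ℝ × U` is a timelike supersymmetric solution of five-dimensional minimal
gauged supergravity with AdS radius `ℓ`, with supersymmetric Killing field `∂_t`, where `t` is the
coordinate of `ℝ`, and with Kähler base data `(f, om, h, J)`. The field `maxwell_eq` says that the
`J`-component `λ₃` in the expansion `G⁻ = ℓ/(2R) λᵢ Ωⁱ` (where `Ω³ = J` and
`Ωⁱ_{ab} Ωʲ^{ab} = 4 δⁱʲ`) is `½ ∇²R + ⅔ R_{ab}R^{ab} - ⅓ R²`; the other two components are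
unconstrained. -/
structure IsTimelikeSusy (ℓ : ℝ) (U : Set ℍ[ℝ])
    (g : ℝ × ℍ[ℝ] → ℝ × ℍ[ℝ] → ℝ × ℍ[ℝ] → ℝ) (F : Tensor2 (ℝ × ℍ[ℝ]))
    (f : ℍ[ℝ] → ℝ) (om : OneForm ℍ[ℝ]) (h J : Tensor2 ℍ[ℝ]) : Prop where
  kahler : IsKahler U h J
  smooth_f : ContDiffOn ℝ ∞ f U
  f_pos : ∀ x ∈ U, 0 < f x
  smooth_omega : ContDiffOn ℝ ∞ om U
  metric_eq : ∀ p : ℝ × ℍ[ℝ], p.2 ∈ U → ∀ X Y : ℝ × ℍ[ℝ],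
    g p X Y = -(f p.2) ^ 2 * (X.1 + om p.2 X.2) * (Y.1 + om p.2 Y.2) + (f p.2)⁻¹ * h p.2 X.2 Y.2
  field_eq : ∀ p : ℝ × ℍ[ℝ], p.2 ∈ U → ∀ X Y : ℝ × ℍ[ℝ],
    F p X Y = Real.sqrt 3 / 2 * extd (timeForm f om) p X Y
      - 1 / Real.sqrt 3 * (∑ a, ∑ b, Gplus f om h J p.2 a b * coord X.2 a * coord Y.2 b)
      - Real.sqrt 3 / (ℓ * f p.2) * J p.2 X.2 Y.2
  f_eq : ∀ x ∈ U, (f x)⁻¹ = -(ℓ ^ 2 / 24) * scalar h x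
  Gplus_eq : ∀ x ∈ U, ∀ a b,
    Gplus f om h J x a b = -(ℓ / 2) * (ricciForm h J x a b - (1 / 4) * comp J x a b * scalar h x)
  maxwell_eq : ∀ x ∈ U,
    (1 / 4) * ∑ a, ∑ b, Gminus f om h J x a b * raise h (comp J x) x a b =
      ℓ / (2 * scalar h x) * ((1 / 2) * laplacian h (scalar h) x + (2 / 3) * ricciSq h x
        - (1 / 3) * scalar h x ^ 2)

/-- A covariant 2-tensor field on `ℝ × I × SU(2)` is invariant under the (right) action of `SU(2)`
by translations `(v, x) ↦ (v, x q)`, `‖q‖ = 1`. -/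
def IsSU2Invariant (I : Set ℝ) (T : Tensor2 (ℝ × ℍ[ℝ])) : Prop :=
  ∀ q : ℍ[ℝ], ‖q‖ = 1 → ∀ p : ℝ × ℍ[ℝ], p.2 ∈ cyl I → ∀ X Y : ℝ × ℍ[ℝ],
    T (p.1, p.2 * q) (X.1, X.2 * q) (Y.1, Y.2 * q) = T p X Y

/-! ## Horizons in Gaussian null coordinates -/

/-- The data `Δ(lam), hᵢ(lam), γᵢⱼ(lam)` of an `SU(2)`-invariant metric in Gaussian null
coordinates. -/
structure GNC where
  Del : ℝ → ℝ
  hor : ℝ → Fin 3 → ℝ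
  gam : ℝ → Matrix (Fin 3) (Fin 3) ℝ

namespace GNC

/-- The metric `- lam² Δ² dv² + 2 dv dlam + 2 lam hᵢ σᵢ dv + γᵢⱼ σᵢ σⱼ` on `ℝ × ℝ × SU(2)`; the
coordinate `v` is that of the first factor and `lam = log ‖x‖` that of the second. -/
noncomputable def metric (D : GNC) (p X Y : ℝ × ℍ[ℝ]) : ℝ :=
  let lam := Real.log ‖p.2‖;
  (X.1 * ds p.2 Y.2 + Y.1 * ds p.2 X.2) - lam ^ 2 * D.Del lam ^ 2 * X.1 * Y.1
    + lam * ∑ i, D.hor lam i * (sigma i p.2 X.2 * Y.1 + sigma i p.2 Y.2 * X.1)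
    + ∑ i, ∑ j, D.gam lam i j * sigma i p.2 X.2 * sigma j p.2 Y.2

/-- The data are those of a smooth horizon `lam = 0`, on the region `lm < lam < lp`, outside which
(for `0 < lam < lp`) the Killing field `∂_v` is timelike. -/
structure IsSmoothHorizon (D : GNC) (lm lp : ℝ) : Prop where
  lm_neg : lm < 0
  lp_pos : 0 < lp
  smooth_Del : ContDiffOn ℝ ∞ D.Del (Ioo lm lp)
  smooth_hor : ∀ i, ContDiffOn ℝ ∞ (fun l => D.hor l i) (Ioo lm lp)
  smooth_gam : ∀ i j, ContDiffOn ℝ ∞ (fun l => D.gam l i j) (Ioo lm lp)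
  posDef_gam : ∀ l ∈ Ioo lm lp, (D.gam l).PosDef
  Del_pos : ∀ l ∈ Ioo 0 lp, 0 < D.Del l

/-- The near-horizon geometry: the data are replaced by their values at the horizon. -/
def nearHorizon (D : GNC) : GNC where
  Del := fun _ => D.Del 0
  hor := fun _ => D.hor 0
  gam := fun _ => D.gam 0

/-- The metric is invariant under the `U(1)` of left translations generated by `L₃`, the
right-invariant vector field dual to `σ₃`. -/
def IsU1Invariant (D : GNC) : Prop :=
  ∀ s : ℝ, ∀ p : ℝ × ℍ[ℝ], p.2 ≠ 0 → ∀ X Y : ℝ × ℍ[ℝ],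
    let q : ℍ[ℝ] := ⟨Real.cos s, 0, 0, Real.sin s⟩
    D.metric (p.1, q * p.2) (X.1, q * X.2) (Y.1, q * Y.2) = D.metric p X Y

/-- `Δ² + hᵢ hⁱ` at the horizon. -/
noncomputable def nhNorm (D : GNC) : ℝ :=
  D.Del 0 ^ 2 + D.hor 0 ⬝ᵥ ((D.gam 0)⁻¹ *ᵥ D.hor 0)

/-- The constants `¼ (Δ² + hₖ hᵏ) (γᵢⱼ + hᵢ hⱼ / Δ²)` of the near-horizon geometry. -/
noncomputable def coneMetric (D : GNC) : Matrix (Fin 3) (Fin 3) ℝ :=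
  Matrix.of fun i j =>
    (1 / 4) * D.nhNorm * (D.gam 0 i j + D.hor 0 i * D.hor 0 j / D.Del 0 ^ 2)

/-- The constants `- 4 hᵢ / (Δ (Δ² + hₖ hᵏ))` of the near-horizon geometry. -/
noncomputable def coneOmega (D : GNC) (i : Fin 3) : ℝ :=
  -4 * D.hor 0 i / (D.Del 0 * D.nhNorm)

/-- The constant `¼ (Δ² + hₖ hᵏ)` of the near-horizon geometry. -/
noncomputable def coneF (D : GNC) : ℝ := (1 / 4) * D.nhNorm

end GNC

/-! ## The standard form of the base data -/

/-- The metric `dρ² + hᵢⱼ(ρ) σᵢ σⱼ` on `ℝ × SU(2)`, where `ρ = log ‖y‖`. -/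
noncomputable def su2Metric (H : ℝ → Matrix (Fin 3) (Fin 3) ℝ) (y X Y : ℍ[ℝ]) : ℝ :=
  ds y X * ds y Y + ∑ i, ∑ j, H (Real.log ‖y‖) i j * sigma i y X * sigma j y Y

/-- The 1-form `wᵢ(ρ) σᵢ` on `ℝ × SU(2)`, where `ρ = log ‖y‖`. -/
noncomputable def su2Form (w : ℝ → Fin 3 → ℝ) (y X : ℍ[ℝ]) : ℝ :=
  ∑ i, w (Real.log ‖y‖) i * sigma i y X

/-- `Ψ` is an `SU(2)`-equivariant diffeomorphism of `(0, lp) × SU(2)` onto `R × SU(2)`, where `R` is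
an interval `(0, ρ₀)` with `0 < ρ₀ ≤ ∞`, that takes `lam` to `ρ(lam)` with `ρ → 0` as `lam → 0`
(the horizon is at `ρ = 0`). -/
structure IsHorizonCoordChange (lp : ℝ) (R : Set ℝ) (Ψ : OpenPartialHomeomorph ℍ[ℝ] ℍ[ℝ])
    (ρ : ℝ → ℝ) : Prop where
  source_eq : Ψ.source = cyl (Ioo 0 lp)
  target_eq : Ψ.target = cyl R
  smooth : ContDiffOn ℝ ∞ Ψ Ψ.source
  smooth_symm : ContDiffOn ℝ ∞ Ψ.symm Ψ.target
  equivariant : ∀ x ∈ Ψ.source, ∀ q : ℍ[ℝ], ‖q‖ = 1 → Ψ (x * q) = Ψ x * q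
  interval : R.OrdConnected ∧ IsOpen R ∧ R ⊆ Ioi 0 ∧ R ∈ 𝓝[>] (0 : ℝ)
  radial : ∀ x ∈ Ψ.source, Real.log ‖Ψ x‖ = ρ (Real.log ‖x‖)
  horizon : Tendsto ρ (𝓝[>] 0) (𝓝[>] 0)

end Sugra

/-!
The metric of a timelike supersymmetric solution, compared with the one in Gaussian null
coordinates, gives `f = lam Δ`, `ω = - (dlam + lam hᵢ σᵢ) / (lam Δ)²` and
`h = (dlam + lam hᵢ σᵢ)² / (lam Δ) + lam Δ γᵢⱼ σᵢ σⱼ` (`IsTimelikeSusy.base_eq`). With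
`N = Δ² + hᵢ hⁱ` and `vⁱ = hⁱ / N`, completing the square (`GNC.base_metric_eq`) yields
`h = Δ / (lam N) dlam² + lam Δ (γᵢⱼ + hᵢ hⱼ / Δ²) (σᵢ + vᵢ dlam / lam) (σⱼ + vⱼ dlam / lam)`.

* The radial coordinate is the arc length `ρ = ∫ (Δ / (lam N))^(1/2) dlam`. Its square is a smooth
  coordinate also across the horizon (`exists_radial`), so `lam` is a smooth function of `ρ²` with
  derivative `N / (4 Δ)` at `0`, and smooth functions of `lam` differ from their values at the
  horizon by `O(ρ²)`. In particular `f = lam Δ` is a smooth function of `ρ²`.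

* The terms `vᵢ dlam / lam` are absorbed by a left translation `k(lam)` with
  `k' = - k v / (2 lam)` (`maurerCartan_twist`), which exists on the whole interval because the
  equation is linear (`exists_unit_solution`). The generator is singular at the horizon, and `k`
  need not have a limit there. By the `U(1)` symmetry of the near-horizon geometry, however, `v` points along
  the third axis at `lam = 0`, so that the singular part of the generator does not move this axis:
  `k e₃ k̄` has a bounded derivative, and a constant rotation brings its limit to `e₃`
  (`exists_frame`). As the limits of `γᵢⱼ + hᵢ hⱼ / Δ²` and `hᵢ` are themselves axially symmetric,
  they are not affected by the rotation up to `O(ρ²)` (`isBigO_rot_conj_sub`,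
  `isBigO_rot_mulVec_sub`), whence the asymptotic form of `h` and `ω`.
-/

namespace Sugra

/-! ### Calculus on an interval -/

/-- Points of the segment from `0` to a point of an interval around `0` stay in the interval. -/
lemma mul_sq_mem_Ioo {a b x s : ℝ} (ha : a < 0) (hb : 0 < b) (hx : x ∈ Ioo a b)
    (hs : s ∈ Icc (0 : ℝ) 1) : x * s ^ 2 ∈ Ioo a b := by
  have h2 : s ^ 2 ∈ Icc (0 : ℝ) 1 := ⟨by positivity, pow_le_one₀ hs.1 hs.2⟩
  simpa [mul_comm] using (convex_Ioo a b).smul_mem_of_zero_mem ⟨ha, hb⟩ hx h2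

/-- Differentiation under the integral sign; it reproduces the form of the integral, so that it can
be iterated. -/
lemma hasDerivAt_integral_pow_mul_comp_mul_sq {φ : ℝ → ℝ} {a b : ℝ} (ha : a < 0) (hb : 0 < b)
    (hφ : ContDiffOn ℝ 1 φ (Ioo a b)) (m : ℕ) {x : ℝ} (hx : x ∈ Ioo a b) :
    HasDerivAt (fun x => ∫ s in (0 : ℝ)..1, s ^ m * φ (x * s ^ 2))
      (∫ s in (0 : ℝ)..1, s ^ (m + 2) * deriv φ (x * s ^ 2)) x := by
  have hcont : ∀ ψ : ℝ → ℝ, ContinuousOn ψ (Ioo a b) → ∀ n : ℕ, ∀ y ∈ Ioo a b,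
      ContinuousOn (fun s : ℝ => s ^ n * ψ (y * s ^ 2)) (Icc 0 1) := fun ψ hψ n y hy =>
    (continuousOn_pow n).mul <| hψ.comp (by fun_prop) fun s hs => mul_sq_mem_Ioo ha hb hy hs
  have hder : ContinuousOn (deriv φ) (Ioo a b) :=
    hφ.continuousOn_deriv_of_isOpen isOpen_Ioo le_rfl
  have hsub : uIoc (0 : ℝ) 1 ⊆ Icc 0 1 := by
    rw [uIoc_of_le zero_le_one]; exact Ioc_subset_Icc_self
  have hint : ∀ ψ : ℝ → ℝ, ContinuousOn ψ (Ioo a b) → ∀ n : ℕ, ∀ y ∈ Ioo a b,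
      IntervalIntegrable (fun s : ℝ => s ^ n * ψ (y * s ^ 2)) MeasureTheory.volume 0 1 :=
    fun ψ hψ n y hy => ContinuousOn.intervalIntegrable (by
      rw [uIcc_of_le zero_le_one]; exact hcont ψ hψ n y hy)
  -- a compact interval around both `0` and `x`, on which the derivative is bounded
  obtain ⟨c, hc, hcx⟩ : ∃ c, a < c ∧ c < min 0 x := exists_between (lt_min ha hx.1)
  obtain ⟨d, hdx, hd⟩ : ∃ d, max 0 x < d ∧ d < b := exists_between (max_lt hb hx.2)
  rw [lt_min_iff] at hcx
  rw [max_lt_iff] at hdx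
  have hcd : Icc c d ⊆ Ioo a b := fun y hy => ⟨hc.trans_le hy.1, hy.2.trans_lt hd⟩
  obtain ⟨C, hC⟩ := isCompact_Icc.exists_bound_of_continuousOn (hder.mono hcd)
  refine (intervalIntegral.hasDerivAt_integral_of_dominated_loc_of_deriv_le
    (F' := fun x s => s ^ (m + 2) * deriv φ (x * s ^ 2)) (bound := fun _ => C)
    (Icc_mem_nhds hcx.2 hdx.2) ?_ (hint φ hφ.continuousOn m x hx) ?_ ?_ (by simp) ?_).2
  · filter_upwards [isOpen_Ioo.mem_nhds hx] with y hy
    exact (intervalIntegrable_iff.1 (hint φ hφ.continuousOn m y hy)).aestronglyMeasurable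
  · exact (intervalIntegrable_iff.1 (hint _ hder (m + 2) x hx)).aestronglyMeasurable
  · refine .of_forall fun s hs y hy => ?_
    have hs' := hsub hs
    have hmem : y * s ^ 2 ∈ Icc c d := by
      have h2 : s ^ 2 ∈ Icc (0 : ℝ) 1 := ⟨by positivity, pow_le_one₀ hs'.1 hs'.2⟩
      simpa [mul_comm] using
        (convex_Icc c d).smul_mem_of_zero_mem ⟨hcx.1.le, hdx.1.le⟩ hy h2
    rw [norm_mul, norm_pow, Real.norm_of_nonneg hs'.1]
    calc s ^ (m + 2) * ‖deriv φ (y * s ^ 2)‖ ≤ 1 * C := by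
          gcongr
          · exact pow_le_one₀ hs'.1 hs'.2
          · exact hC _ hmem
      _ = C := one_mul C
  · refine .of_forall fun s hs y hy => ?_
    have hmem := mul_sq_mem_Ioo ha hb (hcd hy) (hsub hs)
    have h1 : HasDerivAt φ (deriv φ (y * s ^ 2)) (y * s ^ 2) :=
      ((hφ.differentiableOn one_ne_zero).differentiableAt
        (isOpen_Ioo.mem_nhds hmem)).hasDerivAt
    have h2 : HasDerivAt (fun y : ℝ => y * s ^ 2) (s ^ 2) y := by
      simpa using (hasDerivAt_id y).mul_const (s ^ 2)
    exact ((h1.comp y h2).const_mul (s ^ m)).congr_deriv (by ring)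

lemma contDiffOn_integral_pow_mul_comp_mul_sq {a b : ℝ} (ha : a < 0) (hb : 0 < b) (n : ℕ) :
    ∀ (φ : ℝ → ℝ), ContDiffOn ℝ ∞ φ (Ioo a b) → ∀ m : ℕ,
      ContDiffOn ℝ n (fun x => ∫ s in (0 : ℝ)..1, s ^ m * φ (x * s ^ 2)) (Ioo a b) := by
  have key : ∀ φ : ℝ → ℝ, ContDiffOn ℝ ∞ φ (Ioo a b) → ∀ m : ℕ, ∀ x ∈ Ioo a b, _ :=
    fun φ hφ m x hx => hasDerivAt_integral_pow_mul_comp_mul_sq ha hb (hφ.of_le (mod_cast le_top))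
      m hx
  induction n with
  | zero =>
    intro φ hφ m
    exact contDiffOn_zero.2 fun x hx => (key φ hφ m x hx).continuousAt.continuousWithinAt
  | succ n ih =>
    intro φ hφ m
    push_cast
    refine (contDiffOn_succ_iff_deriv_of_isOpen isOpen_Ioo).2
      ⟨fun x hx => (key φ hφ m x hx).differentiableAt.differentiableWithinAt, by simp, ?_⟩
    exact (ih (deriv φ) (hφ.deriv_of_isOpen isOpen_Ioo le_rfl) (m + 2)).congr
      fun x hx => (key φ hφ m x hx).deriv

/-- A function with positive derivative on an open interval is a diffeomorphism onto its image. -/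
lemma exists_smooth_inverse {Q : ℝ → ℝ} {a b : ℝ} (hQ : ContDiffOn ℝ ∞ Q (Ioo a b))
    (hd : ∀ x ∈ Ioo a b, 0 < deriv Q x) :
    StrictMonoOn Q (Ioo a b) ∧ IsOpen (Q '' Ioo a b) ∧
      ∃ L : ℝ → ℝ, ContDiffOn ℝ ∞ L (Q '' Ioo a b) ∧ ∀ x ∈ Ioo a b, L (Q x) = x := by
  have hmono : StrictMonoOn Q (Ioo a b) :=
    strictMonoOn_of_deriv_pos (convex_Ioo a b) hQ.continuousOn (by simpa using hd)
  have hat : ∀ x ∈ Ioo a b, ContDiffAt ℝ ∞ Q x := fun x hx =>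
    hQ.contDiffAt (isOpen_Ioo.mem_nhds hx)
  have hstrict : ∀ x ∈ Ioo a b, HasStrictDerivAt Q (deriv Q x) x := fun x hx =>
    (hat x hx).hasStrictDerivAt (by simp)
  have hopen : IsOpenMap ((Ioo a b).domRestrict Q) := by
    refine IsOpenMap.of_nhds_le fun x => ?_
    have h1 := (hstrict x x.2).map_nhds_eq (hd x x.2).ne'
    have h2 : map ((↑) : Ioo a b → ℝ) (𝓝 x) = 𝓝 (x : ℝ) := by
      rw [map_nhds_subtype_coe_eq_nhds x.2 (isOpen_Ioo.mem_nhds x.2)]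
    have h3 : map ((Ioo a b).domRestrict Q) (𝓝 x) = map Q (map (↑) (𝓝 x)) := rfl
    rw [h3, h2, h1]
    rfl
  let e : OpenPartialHomeomorph ℝ ℝ := OpenPartialHomeomorph.ofContinuousOpenRestrict
    (hmono.injOn.toPartialEquiv Q (Ioo a b)) hQ.continuousOn hopen isOpen_Ioo
  have htgt : e.target = Q '' Ioo a b := rfl
  refine ⟨hmono, htgt ▸ e.open_target, e.symm, ?_, fun x hx => e.left_inv hx⟩
  intro y hy
  rw [← htgt] at hy
  have hmem : e.symm y ∈ Ioo a b := e.map_target hy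
  exact (e.contDiffAt_symm_deriv (hd _ hmem).ne' hy (hstrict _ hmem).hasDerivAt
    (hat _ hmem)).contDiffWithinAt

/-- A `C²` function which vanishes to first order at `0` is `O(s²)`. -/
lemma isBigO_sq_of_deriv_eq_zero {f : ℝ → ℝ} {U : Set ℝ} (hU : IsOpen U) (h0 : (0 : ℝ) ∈ U)
    (hf : ContDiffOn ℝ ∞ f U) (hf0 : f 0 = 0) (hf1 : deriv f 0 = 0) :
    f =O[𝓝 0] fun s => s ^ 2 := by
  have hd : DifferentiableAt ℝ (deriv f) 0 :=
    ((hf.deriv_of_isOpen hU (m := ∞) le_rfl).differentiableOn (by simp)).differentiableAt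
      (hU.mem_nhds h0)
  have h1 := hd.isBigO_sub
  simp only [hf1, sub_zero] at h1
  obtain ⟨C, hC⟩ := h1.bound
  obtain ⟨ε, hε, hball⟩ := Metric.eventually_nhds_iff_ball.1 (hC.and (hU.mem_nhds h0))
  refine IsBigO.of_bound C ?_
  filter_upwards [Metric.ball_mem_nhds 0 hε] with s hs
  have hsub : Metric.closedBall (0 : ℝ) |s| ⊆ Metric.ball 0 ε :=
    Metric.closedBall_subset_ball (by simpa using hs)
  have := (convex_closedBall (0 : ℝ) |s|).norm_image_sub_le_of_norm_deriv_le (f := f)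
    (C := C * |s|) (x := 0) (y := s)
    (fun x hx => (hf.differentiableOn (by simp)).differentiableAt
      (hU.mem_nhds (hball x (hsub hx)).2))
    (fun x hx => (hball x (hsub hx)).1.trans (by
      have hC0 : 0 ≤ C ∨ x = 0 := by
        by_contra! h
        have := (norm_nonneg _).trans (hball x (hsub hx)).1
        nlinarith [norm_pos_iff.2 h.2]
      have hx' : ‖x‖ ≤ |s| := by simpa using hx
      rcases hC0 with h | h
      · gcongr
      · have hs1 := (norm_nonneg _).trans (hball s (hsub (by simp))).1
        rw [h]; simpa using hs1))
    (by simp) (by simp)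
  simpa [hf0, sq, mul_assoc] using this

/-! ### Linear differential equations in the unit quaternions -/

/-- The radial retraction of the quaternions onto the closed unit ball. -/
noncomputable def retract (x : ℍ[ℝ]) : ℍ[ℝ] := (max 1 ‖x‖)⁻¹ • x

lemma norm_retract_le (x : ℍ[ℝ]) : ‖retract x‖ ≤ 1 := by
  have h : 0 < max 1 ‖x‖ := lt_max_of_lt_left one_pos
  rw [retract, norm_smul, norm_inv, Real.norm_of_nonneg h.le, inv_mul_le_iff₀ h]
  simp

lemma retract_of_norm_le_one {x : ℍ[ℝ]} (h : ‖x‖ ≤ 1) : retract x = x := by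
  simp [retract, max_eq_left h]

lemma norm_retract_sub_le (x y : ℍ[ℝ]) : ‖retract x - retract y‖ ≤ 2 * ‖x - y‖ := by
  set α := max 1 ‖x‖ with hα
  set β := max 1 ‖y‖ with hβ
  have hα1 : 1 ≤ α := le_max_left _ _
  have hβ1 : 1 ≤ β := le_max_left _ _
  have hyβ : ‖y‖ ≤ β := le_max_right _ _
  have hαβ : |α - β| ≤ ‖x - y‖ := by
    calc |α - β| ≤ |‖x‖ - ‖y‖| := by
          simpa [hα, hβ] using abs_max_sub_max_le_max 1 ‖x‖ 1 ‖y‖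
      _ ≤ ‖x - y‖ := abs_norm_sub_norm_le x y
  have hα0 : 0 < α := by linarith
  have hβ0 : 0 < β := by linarith
  have heq : retract x - retract y = α⁻¹ • (x - y) + ((β - α) * (α⁻¹ * β⁻¹)) • y := by
    have : (β - α) * (α⁻¹ * β⁻¹) = α⁻¹ - β⁻¹ := by field_simp
    rw [this, retract, retract, smul_sub, sub_smul]
    abel
  rw [heq]
  refine (norm_add_le _ _).trans ?_
  have h1 : ‖α⁻¹ • (x - y)‖ ≤ ‖x - y‖ := by
    rw [norm_smul, Real.norm_of_nonneg (by positivity)]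
    exact mul_le_of_le_one_left (norm_nonneg _) (inv_le_one_of_one_le₀ hα1)
  have h2 : ‖((β - α) * (α⁻¹ * β⁻¹)) • y‖ ≤ ‖x - y‖ := by
    rw [norm_smul, norm_mul, Real.norm_eq_abs, abs_sub_comm,
      Real.norm_of_nonneg (by positivity : 0 ≤ α⁻¹ * β⁻¹)]
    have : α⁻¹ * (β⁻¹ * ‖y‖) ≤ 1 := mul_le_one₀ (inv_le_one_of_one_le₀ hα1) (by positivity)
      (by rw [inv_mul_le_iff₀ hβ0]; simpa using hyβ)
    calc |α - β| * (α⁻¹ * β⁻¹) * ‖y‖ = |α - β| * (α⁻¹ * (β⁻¹ * ‖y‖)) := by ring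
      _ ≤ ‖x - y‖ * 1 := by gcongr
      _ = ‖x - y‖ := mul_one _
  linarith

lemma inner_mul_right_eq_zero {x b : ℍ[ℝ]} (hb : b.re = 0) : inner ℝ x (x * b) = 0 := by
  rw [Quaternion.inner_def]
  simp [hb]
  ring

/-- The equation `k' = k B` with `B` imaginary can be solved in the unit quaternions on a compact
interval. Its right-hand side is first made bounded by the radial retraction, so that the
Picard-Lindelöf theorem applies on the whole interval; as the norm is conserved, the retraction
has no effect. -/
lemma exists_unit_solution_of_Icc {B : ℝ → ℍ[ℝ]} {c d t₀ : ℝ} (ht₀ : t₀ ∈ Ioo c d)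
    (hB : ContinuousOn B (Icc c d)) (him : ∀ t, (B t).re = 0) :
    ∃ k : ℝ → ℍ[ℝ], k t₀ = 1 ∧ ∀ t ∈ Ioo c d, HasDerivAt k (k t * B t) t ∧ ‖k t‖ = 1 := by
  obtain ⟨M, hM⟩ := isCompact_Icc.exists_bound_of_continuousOn hB
  have hM0 : 0 ≤ M := (norm_nonneg _).trans (hM t₀ (Ioo_subset_Icc_self ht₀))
  have hT : 0 ≤ max (d - t₀) (t₀ - c) := le_max_of_le_left (by linarith [ht₀.2])
  have hPL : IsPicardLindelof (fun t x => retract x * B t)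
      (⟨t₀, Ioo_subset_Icc_self ht₀⟩ : Icc c d) 1
      (⟨M * max (d - t₀) (t₀ - c), by positivity⟩ : NNReal) 0 ⟨M, hM0⟩ ⟨2 * M, by positivity⟩ := by
    refine ⟨fun t ht => ?_, fun x _ => continuousOn_const.mul hB, fun t ht x _ => ?_, ?_⟩
    · refine LipschitzWith.lipschitzOnWith (LipschitzWith.of_dist_le_mul fun x y => ?_)
      rw [dist_eq_norm, dist_eq_norm, ← sub_mul, norm_mul]
      calc ‖retract x - retract y‖ * ‖B t‖ ≤ (2 * ‖x - y‖) * M := by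
            gcongr
            · exact norm_retract_sub_le x y
            · exact hM t ht
        _ = 2 * M * ‖x - y‖ := by ring
    · rw [norm_mul]
      calc ‖retract x‖ * ‖B t‖ ≤ 1 * M := by
            gcongr
            · exact norm_retract_le x
            · exact hM t ht
        _ = M := one_mul M
    · rw [NNReal.coe_zero, sub_zero]; exact le_rfl
  obtain ⟨k, hk0, hk⟩ := hPL.exists_eq_forall_mem_Icc_hasDerivWithinAt₀
  have hk' : ∀ t ∈ Ioo c d, HasDerivAt k (retract (k t) * B t) t := fun t ht =>
    (hk t (Ioo_subset_Icc_self ht)).hasDerivAt (Icc_mem_nhds ht.1 ht.2)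
  have hsq : ∀ t ∈ Ioo c d, HasDerivAt (fun t => ‖k t‖ ^ 2) 0 t := fun t ht => by
    refine (hk' t ht).norm_sq.congr_deriv ?_
    rw [retract, smul_mul_assoc, inner_smul_right, inner_mul_right_eq_zero (him t)]
    simp
  have hnorm : ∀ t ∈ Ioo c d, ‖k t‖ = 1 := fun t ht => by
    have h := isOpen_Ioo.is_const_of_deriv_eq_zero (convex_Ioo c d).isPreconnected
      (fun t ht => (hsq t ht).differentiableAt.differentiableWithinAt)
      (fun t ht => (hsq t ht).deriv) ht ht₀
    simp only [hk0, norm_one, one_pow] at h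
    exact (pow_eq_one_iff_of_nonneg (norm_nonneg _) two_ne_zero).1 h
  refine ⟨k, hk0, fun t ht => ⟨?_, hnorm t ht⟩⟩
  simpa [retract_of_norm_le_one (hnorm t ht).le] using hk' t ht

/-- Solutions of `k' = k B` are as smooth as `B` allows. -/
lemma contDiffOn_of_hasDerivAt_mul {B k : ℝ → ℍ[ℝ]} {U : Set ℝ} (hU : IsOpen U)
    (hB : ContDiffOn ℝ ∞ B U) (hk : ∀ t ∈ U, HasDerivAt k (k t * B t) t) :
    ContDiffOn ℝ ∞ k U := by
  refine contDiffOn_infty.2 fun n => ?_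
  induction n with
  | zero => exact contDiffOn_zero.2 fun t ht => (hk t ht).continuousAt.continuousWithinAt
  | succ n ih =>
    push_cast
    refine (contDiffOn_succ_iff_deriv_of_isOpen hU).2
      ⟨fun t ht => (hk t ht).differentiableAt.differentiableWithinAt, by simp, ?_⟩
    exact (ih.mul (hB.of_le (mod_cast le_top))).congr fun t ht => (hk t ht).deriv

/-- The equation `k' = k B` with `B` imaginary and smooth on an open interval has a smooth solution
in the unit quaternions on the whole interval: the solutions on the compact subintervals agree. -/
lemma exists_unit_solution {B : ℝ → ℍ[ℝ]} {a b : ℝ} (hab : a < b)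
    (hB : ContDiffOn ℝ ∞ B (Ioo a b)) (him : ∀ t, (B t).re = 0) :
    ∃ k : ℝ → ℍ[ℝ], ContDiffOn ℝ ∞ k (Ioo a b) ∧
      ∀ t ∈ Ioo a b, HasDerivAt k (k t * B t) t ∧ ‖k t‖ = 1 := by
  obtain ⟨t₀, ht₀⟩ := exists_between hab
  have hloc : ∀ c d : ℝ, ∃ k : ℝ → ℍ[ℝ], a < c → t₀ ∈ Ioo c d → d < b →
      k t₀ = 1 ∧ ∀ t ∈ Ioo c d, HasDerivAt k (k t * B t) t ∧ ‖k t‖ = 1 := fun c d => by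
    by_cases h : a < c ∧ t₀ ∈ Ioo c d ∧ d < b
    · obtain ⟨k, hk⟩ := exists_unit_solution_of_Icc h.2.1
        (hB.continuousOn.mono fun t ht => ⟨h.1.trans_le ht.1, ht.2.trans_lt h.2.2⟩) him
      exact ⟨k, fun _ _ _ => hk⟩
    · exact ⟨0, fun h1 h2 h3 => absurd ⟨h1, h2, h3⟩ h⟩
  choose K hK using hloc
  have hagree : ∀ c d c' d' : ℝ, a < c → t₀ ∈ Ioo c d → d < b → a < c' → t₀ ∈ Ioo c' d' → d' < b →
      ∀ t ∈ Ioo c d, t ∈ Ioo c' d' → K c d t = K c' d' t := by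
    intro c d c' d' h1 h2 h3 h1' h2' h3' t ht ht'
    obtain ⟨M, hM⟩ := (isCompact_Icc (a := c) (b := d)).exists_bound_of_continuousOn
      (hB.continuousOn.mono fun t ht => ⟨h1.trans_le ht.1, ht.2.trans_lt h3⟩)
    have hM0 : 0 ≤ M := (norm_nonneg _).trans (hM t₀ (Ioo_subset_Icc_self h2))
    have hsub : ∀ s ∈ Ioo (max c c') (min d d'), s ∈ Ioo c d ∧ s ∈ Ioo c' d' := fun s hs => by
      obtain ⟨h1, h2⟩ := hs
      rw [max_lt_iff] at h1
      rw [lt_min_iff] at h2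
      exact ⟨⟨h1.1, h2.1⟩, h1.2, h2.2⟩
    refine ODE_solution_unique_of_mem_Ioo (v := fun s x => x * B s) (K := ⟨M, hM0⟩)
      (s := fun _ => univ) (a := max c c') (b := min d d') (t₀ := t₀) ?_ ?_ ?_ ?_ ?_ ?_
    · intro s hs
      refine LipschitzWith.lipschitzOnWith (LipschitzWith.of_dist_le_mul fun x y => ?_)
      rw [dist_eq_norm, dist_eq_norm, ← sub_mul, norm_mul, mul_comm]
      exact mul_le_mul_of_nonneg_right (hM s (Ioo_subset_Icc_self (hsub s hs).1)) (norm_nonneg _)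
    · exact ⟨max_lt h2.1 h2'.1, lt_min h2.2 h2'.2⟩
    · exact fun s hs => ⟨((hK c d h1 h2 h3).2 s (hsub s hs).1).1, mem_univ _⟩
    · exact fun s hs => ⟨((hK c' d' h1' h2' h3').2 s (hsub s hs).2).1, mem_univ _⟩
    · rw [(hK c d h1 h2 h3).1, (hK c' d' h1' h2' h3').1]
    · exact ⟨max_lt ht.1 ht'.1, lt_min ht.2 ht'.2⟩
  -- a compact interval with `t₀` and `t` in its interior
  let c : ℝ → ℝ := fun t => (a + min t t₀) / 2
  let d : ℝ → ℝ := fun t => (max t t₀ + b) / 2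
  have hcd : ∀ t ∈ Ioo a b, a < c t ∧ t₀ ∈ Ioo (c t) (d t) ∧ d t < b ∧ t ∈ Ioo (c t) (d t) := by
    intro t ht
    have h1 : a < min t t₀ := lt_min ht.1 ht₀.1
    have h2 : max t t₀ < b := max_lt ht.2 ht₀.2
    have h3 := min_le_left t t₀
    have h4 := min_le_right t t₀
    have h5 := le_max_left t t₀
    have h6 := le_max_right t t₀
    refine ⟨?_, ⟨?_, ?_⟩, ?_, ⟨?_, ?_⟩⟩ <;> simp only [c, d] <;> linarith
  let k : ℝ → ℍ[ℝ] := fun t => K (c t) (d t) t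
  have hk : ∀ t ∈ Ioo a b, HasDerivAt k (k t * B t) t ∧ ‖k t‖ = 1 := by
    intro t ht
    obtain ⟨h1, h2, h3, h4⟩ := hcd t ht
    have hsol := (hK (c t) (d t) h1 h2 h3).2 t h4
    refine ⟨hsol.1.congr_of_eventuallyEq ?_, hsol.2⟩
    filter_upwards [isOpen_Ioo.mem_nhds h4] with s hs
    have hs' : s ∈ Ioo a b := ⟨h1.trans hs.1, hs.2.trans h3⟩
    obtain ⟨h1', h2', h3', h4'⟩ := hcd s hs'
    exact hagree _ _ _ _ h1' h2' h3' h1 h2 h3 s h4' hs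
  exact ⟨k, contDiffOn_of_hasDerivAt_mul isOpen_Ioo hB fun t ht => (hk t ht).1, hk⟩

/-! ### Rotations by unit quaternions -/

/-- The imaginary part of a quaternion, as a vector of `ℝ³`. -/
def imVec (x : ℍ[ℝ]) : Fin 3 → ℝ := ![x.imI, x.imJ, x.imK]

/-- The imaginary quaternion with given components. -/
def ofIm (a : Fin 3 → ℝ) : ℍ[ℝ] := ⟨0, a 0, a 1, a 2⟩

/-- The matrix of `x ↦ k x k̄` on imaginary quaternions, a rotation if `k` is a unit quaternion. -/
def rot (k : ℍ[ℝ]) : Matrix (Fin 3) (Fin 3) ℝ :=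
  !![k.re ^ 2 + k.imI ^ 2 - k.imJ ^ 2 - k.imK ^ 2, 2 * (k.imI * k.imJ - k.re * k.imK),
      2 * (k.imI * k.imK + k.re * k.imJ);
    2 * (k.imI * k.imJ + k.re * k.imK), k.re ^ 2 - k.imI ^ 2 + k.imJ ^ 2 - k.imK ^ 2,
      2 * (k.imJ * k.imK - k.re * k.imI);
    2 * (k.imI * k.imK - k.re * k.imJ), 2 * (k.imJ * k.imK + k.re * k.imI),
      k.re ^ 2 - k.imI ^ 2 - k.imJ ^ 2 + k.imK ^ 2]

@[simp] lemma re_ofIm (a : Fin 3 → ℝ) : (ofIm a).re = 0 := rfl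

@[simp] lemma imI_ofIm (a : Fin 3 → ℝ) : (ofIm a).imI = a 0 := rfl

@[simp] lemma imJ_ofIm (a : Fin 3 → ℝ) : (ofIm a).imJ = a 1 := rfl

@[simp] lemma imK_ofIm (a : Fin 3 → ℝ) : (ofIm a).imK = a 2 := rfl

@[simp] lemma imVec_ofIm (a : Fin 3 → ℝ) : imVec (ofIm a) = a := by
  ext i; fin_cases i <;> rfl

lemma norm_eq_one_iff {k : ℍ[ℝ]} :
    ‖k‖ = 1 ↔ k.re ^ 2 + k.imI ^ 2 + k.imJ ^ 2 + k.imK ^ 2 = 1 := by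
  rw [← Quaternion.normSq_def', Quaternion.normSq_eq_norm_mul_self, ← sq,
    pow_eq_one_iff_of_nonneg (norm_nonneg _) two_ne_zero]

lemma mul_star_of_norm_eq_one {k : ℍ[ℝ]} (hk : ‖k‖ = 1) : k * star k = 1 := by
  rw [Quaternion.self_mul_star, Quaternion.normSq_eq_norm_mul_self, hk]; simp

lemma star_mul_of_norm_eq_one {k : ℍ[ℝ]} (hk : ‖k‖ = 1) : star k * k = 1 := by
  rw [Quaternion.star_mul_self, Quaternion.normSq_eq_norm_mul_self, hk]; simp

lemma inv_eq_star_of_norm_eq_one {k : ℍ[ℝ]} (hk : ‖k‖ = 1) : k⁻¹ = star k :=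
  inv_eq_of_mul_eq_one_right (mul_star_of_norm_eq_one hk)

lemma imVec_conj (k x : ℍ[ℝ]) : imVec (k * x * star k) = rot k *ᵥ imVec x := by
  ext i
  fin_cases i <;> simp [imVec, rot, Matrix.mulVec, dotProduct, Fin.sum_univ_three] <;> ring

lemma rot_mul_transpose {k : ℍ[ℝ]} (hk : ‖k‖ = 1) : rot k * (rot k)ᵀ = 1 := by
  have h := norm_eq_one_iff.1 hk
  have h2 : (k.re ^ 2 + k.imI ^ 2 + k.imJ ^ 2 + k.imK ^ 2) ^ 2 = 1 := by rw [h]; norm_num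
  ext i j
  fin_cases i <;> fin_cases j <;>
    simp [rot, Matrix.mul_apply, Fin.sum_univ_three] <;> first | linear_combination h2 | ring

lemma abs_rot_le_one {k : ℍ[ℝ]} (hk : ‖k‖ = 1) (i j : Fin 3) : |rot k i j| ≤ 1 := by
  have h := congr_fun (congr_fun (rot_mul_transpose hk) i) i
  rw [Matrix.mul_apply] at h
  simp only [Matrix.transpose_apply, Matrix.one_apply_eq, ← sq] at h
  have h2 : rot k i j ^ 2 ≤ 1 := h ▸ Finset.single_le_sum (f := fun j => rot k i j ^ 2)
    (fun j _ => sq_nonneg _) (Finset.mem_univ j)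
  exact (sq_le_one_iff_abs_le_one _).1 h2

lemma abs_imVec_le_norm (x : ℍ[ℝ]) (i : Fin 3) : |imVec x i| ≤ ‖x‖ := by
  have h : ‖x‖ ^ 2 = x.re ^ 2 + x.imI ^ 2 + x.imJ ^ 2 + x.imK ^ 2 := by
    rw [← Quaternion.normSq_def', Quaternion.normSq_eq_norm_mul_self, sq]
  refine abs_le_of_sq_le_sq ?_ (norm_nonneg x)
  rw [h]
  fin_cases i <;> simp [imVec] <;>
    nlinarith [sq_nonneg x.re, sq_nonneg x.imI, sq_nonneg x.imJ, sq_nonneg x.imK]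

/-- The third imaginary unit, which generates the rotations by `L₃`. -/
def e₃ : ℍ[ℝ] := ofIm ![0, 0, 1]

lemma rot_mulVec_axis (k : ℍ[ℝ]) : rot k *ᵥ ![0, 0, 1] = imVec (k * e₃ * star k) := by
  rw [imVec_conj, e₃, imVec_ofIm]

lemma e₃_mul_self : e₃ * e₃ = -1 := by
  ext <;> simp [e₃]

/-- Every square root of `-1` is conjugate to the third imaginary unit. -/
lemma exists_unit_mul_eq_e₃_mul {n : ℍ[ℝ]} (hn : n * n = -1) :
    ∃ q : ℍ[ℝ], ‖q‖ = 1 ∧ q * n = e₃ * q := by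
  by_cases h : 1 - e₃ * n = 0
  · -- here `n = - e₃`, and a rotation by `π` about another axis will do
    have hn' : n = -e₃ := by
      have h1 : e₃ * n = 1 := (sub_eq_zero.1 h).symm
      calc n = -(e₃ * e₃) * n := by rw [e₃_mul_self]; simp
        _ = -(e₃ * (e₃ * n)) := by rw [neg_mul, mul_assoc]
        _ = -e₃ := by rw [h1, mul_one]
    refine ⟨ofIm ![1, 0, 0], norm_eq_one_iff.2 (by simp), ?_⟩
    rw [hn']
    ext <;> simp [e₃]
  · refine ⟨‖1 - e₃ * n‖⁻¹ • (1 - e₃ * n), norm_smul_inv_norm (𝕜 := ℝ) h, ?_⟩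
    rw [smul_mul_assoc, mul_smul_comm]
    congr 1
    rw [sub_mul, mul_sub, one_mul, mul_one, mul_assoc, hn, ← mul_assoc, e₃_mul_self]
    simp [add_comm]

/-! ### The rotating frame -/

/-- A Lipschitz function on an interval `(0, δ)` has a limit at `0`, which it approaches linearly. -/
lemma exists_limit_of_lipschitz {E : Type*} [NormedAddCommGroup E] [CompleteSpace E]
    {n : ℝ → E} {δ C : ℝ} (hδ : 0 < δ)
    (h : ∀ s ∈ Ioo 0 δ, ∀ t ∈ Ioo 0 δ, ‖n t - n s‖ ≤ C * ‖t - s‖) :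
    ∃ n₀, Tendsto n (𝓝[>] 0) (𝓝 n₀) ∧ ∀ t ∈ Ioo 0 δ, ‖n t - n₀‖ ≤ C * t := by
  have hC : 0 ≤ C := by
    have := (norm_nonneg _).trans (h (δ / 3) ⟨by linarith, by linarith⟩ (2 * δ / 3)
      ⟨by linarith, by linarith⟩)
    exact nonneg_of_mul_nonneg_left this (norm_pos_iff.2 (by linarith))
  have hlip : LipschitzOnWith ⟨C, hC⟩ n (Ioo 0 δ) :=
    LipschitzOnWith.of_dist_le_mul fun t ht s hs => by
      rw [dist_eq_norm, dist_eq_norm]; exact h s hs t ht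
  have hmem : Ioo 0 δ ∈ 𝓝[>] (0 : ℝ) := Ioo_mem_nhdsGT hδ
  have hcauchy : Cauchy (map n (𝓝[>] 0)) :=
    (cauchy_nhds.mono' inferInstance nhdsWithin_le_nhds).map_of_le hlip.uniformContinuousOn
      (le_principal_iff.2 hmem)
  obtain ⟨n₀, hn₀⟩ := CompleteSpace.complete hcauchy
  refine ⟨n₀, hn₀, fun t ht => ?_⟩
  have h1 : Tendsto (fun s => ‖n t - n s‖) (𝓝[>] 0) (𝓝 ‖n t - n₀‖) :=
    (tendsto_const_nhds.sub hn₀).norm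
  have h2 : Tendsto (fun s => C * ‖t - s‖) (𝓝[>] (0 : ℝ)) (𝓝 (C * ‖t - 0‖)) :=
    ((tendsto_const_nhds.sub tendsto_id).norm.const_mul C).mono_left nhdsWithin_le_nhds
  have := le_of_tendsto_of_tendsto h1 h2 (by
    filter_upwards [hmem] with s hs using h s hs t ht)
  simpa [abs_of_pos ht.1] using this

/-- The generator of the frame that absorbs the shift `vᵢ(t) dt / t`. It is singular at `t = 0`. -/
noncomputable def shiftGen (v : ℝ → Fin 3 → ℝ) (t : ℝ) : ℍ[ℝ] := ofIm fun i => -v t i / (2 * t)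

lemma contDiffOn_ofIm {a : ℝ → Fin 3 → ℝ} {U : Set ℝ}
    (ha : ∀ i, ContDiffOn ℝ ∞ (fun t => a t i) U) : ContDiffOn ℝ ∞ (fun t => ofIm (a t)) U := by
  have h : (fun t => ofIm (a t)) = fun t =>
      a t 0 • ofIm ![1, 0, 0] + a t 1 • ofIm ![0, 1, 0]
        + a t 2 • ofIm ![0, 0, 1] := by
    funext t; ext <;> simp
  rw [h]
  exact (((ha 0).smul contDiffOn_const).add ((ha 1).smul contDiffOn_const)).add
    ((ha 2).smul contDiffOn_const)

lemma star_of_re_eq_zero {x : ℍ[ℝ]} (hx : x.re = 0) : star x = -x := by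
  ext <;> simp [hx]

/-- A frame `k` of unit quaternions with `k' = k B`, for the singular generator `B` of a shift along
the third axis at `t = 0`. Although `k` itself may rotate indefinitely about that axis as `t → 0`, the
rotated axis `k e₃ k̄` has a bounded derivative, because only the regular transversal part of `B`
moves it; a constant rotation makes its limit `e₃`. -/
lemma exists_frame {v : ℝ → Fin 3 → ℝ} {a b : ℝ} (ha : a < 0) (hb : 0 < b)
    (hv : ∀ i, ContDiffOn ℝ ∞ (fun t => v t i) (Ioo a b)) (h0 : v 0 0 = 0) (h1 : v 0 1 = 0) :
    ∃ k : ℝ → ℍ[ℝ], ContDiffOn ℝ ∞ k (Ioo 0 b) ∧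
      (∀ t ∈ Ioo 0 b, HasDerivAt k (k t * shiftGen v t) t ∧ ‖k t‖ = 1) ∧
      (fun t => k t * e₃ * star (k t) - e₃) =O[𝓝[>] 0] fun t => t := by
  have hB : ContDiffOn ℝ ∞ (shiftGen v) (Ioo 0 b) := contDiffOn_ofIm fun i =>
    ((hv i).mono (Ioo_subset_Ioo_left ha.le)).neg.div (by fun_prop) fun t ht => by
      have := ht.1; positivity
  obtain ⟨k, hks, hk⟩ := exists_unit_solution hb hB fun t => rfl
  let n : ℝ → ℍ[ℝ] := fun t => k t * e₃ * star (k t)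
  have hn : ∀ t ∈ Ioo 0 b, HasDerivAt n
      (k t * (shiftGen v t * e₃ - e₃ * shiftGen v t) * star (k t)) t := fun t ht => by
    have hd := (hk t ht).1
    have : StarModule ℝ ℍ[ℝ] := ⟨fun r x => by ext <;> simp⟩
    have hs : HasDerivAt (fun t => star (k t)) (star (k t * shiftGen v t)) t := hd.star
    refine ((hd.mul_const e₃).mul hs).congr_deriv ?_
    rw [star_mul, star_of_re_eq_zero (x := shiftGen v t) rfl]
    noncomm_ring
  -- the transversal components of the shift vanish at `t = 0`
  have hO : ∀ i, v 0 i = 0 → (fun t => v t i) =O[𝓝 0] fun t => t := fun i hi => by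
    have := (((hv i).differentiableOn (by simp)).differentiableAt
      (isOpen_Ioo.mem_nhds ⟨ha, hb⟩)).isBigO_sub
    simpa [hi] using this
  obtain ⟨C₀, hC₀⟩ := (hO 0 h0).bound
  obtain ⟨C₁, hC₁⟩ := (hO 1 h1).bound
  obtain ⟨ε, hε, hball⟩ := Metric.eventually_nhds_iff_ball.1 (hC₀.and hC₁)
  set δ := min ε b with hδ
  have hδ0 : 0 < δ := lt_min hε hb
  have hbound : ∀ t ∈ Ioo 0 δ,
      ‖k t * (shiftGen v t * e₃ - e₃ * shiftGen v t) * star (k t)‖ ≤ C₀ + C₁ := by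
    intro t ht
    have htb : t ∈ Ioo 0 b := ⟨ht.1, ht.2.trans_le (min_le_right _ _)⟩
    have hcomm : shiftGen v t * e₃ - e₃ * shiftGen v t
        = (-v t 1 / t) • ofIm ![1, 0, 0] + (v t 0 / t) • ofIm ![0, 1, 0] := by
      have := ht.1.ne'
      ext <;> simp [shiftGen, e₃] <;> field_simp <;> ring_nf
    have hb := hball t (by
      simpa [abs_of_pos ht.1] using ht.2.trans_le (min_le_left _ _))
    have hI : ‖ofIm ![1, 0, 0]‖ = 1 := norm_eq_one_iff.2 (by simp)
    have hJ : ‖ofIm ![0, 1, 0]‖ = 1 := norm_eq_one_iff.2 (by simp)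
    rw [norm_mul, norm_mul, (hk t htb).2, norm_star, (hk t htb).2, one_mul, mul_one, hcomm]
    refine (norm_add_le _ _).trans ?_
    rw [norm_smul, norm_smul, hI, hJ, mul_one, mul_one, norm_div, norm_neg, norm_div]
    have ht' : 0 < ‖t‖ := norm_pos_iff.2 ht.1.ne'
    have e1 := (div_le_iff₀ ht').2 hb.1
    have e2 := (div_le_iff₀ ht').2 hb.2
    linarith
  have hlip : ∀ s ∈ Ioo 0 δ, ∀ t ∈ Ioo 0 δ, ‖n t - n s‖ ≤ (C₀ + C₁) * ‖t - s‖ :=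
    fun s hs t ht => (convex_Ioo 0 δ).norm_image_sub_le_of_norm_hasDerivWithin_le
      (fun r hr => (hn r ⟨hr.1, hr.2.trans_le (min_le_right _ _)⟩).hasDerivWithinAt)
      hbound hs ht
  obtain ⟨n₀, hlim, hrate⟩ := exists_limit_of_lipschitz hδ0 hlip
  have hsq : n₀ * n₀ = -1 := by
    refine tendsto_nhds_unique (hlim.mul hlim) (tendsto_const_nhds.congr' ?_)
    filter_upwards [Ioo_mem_nhdsGT hb] with t ht
    have h := star_mul_of_norm_eq_one (hk t ht).2
    have h' := mul_star_of_norm_eq_one (hk t ht).2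
    symm
    calc k t * e₃ * star (k t) * (k t * e₃ * star (k t))
        = k t * e₃ * (star (k t) * k t) * e₃ * star (k t) := by noncomm_ring
      _ = k t * (e₃ * e₃) * star (k t) := by rw [h]; noncomm_ring
      _ = -1 := by rw [e₃_mul_self, mul_neg_one, neg_mul, h']
  obtain ⟨q, hq, hqn⟩ := exists_unit_mul_eq_e₃_mul hsq
  refine ⟨fun t => q * k t, contDiffOn_const.mul hks, fun t ht => ⟨?_, ?_⟩, ?_⟩
  · simpa [mul_assoc] using (hk t ht).1.const_mul q
  · rw [norm_mul, hq, (hk t ht).2, one_mul]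
  · refine IsBigO.of_bound (C₀ + C₁) ?_
    filter_upwards [Ioo_mem_nhdsGT hδ0] with t ht
    have heq : q * k t * e₃ * star (q * k t) - e₃ = q * (n t - n₀) * star q := by
      have : q * n₀ * star q = e₃ := by
        rw [hqn, mul_assoc, mul_star_of_norm_eq_one hq, mul_one]
      rw [mul_sub, sub_mul, this, star_mul]
      simp only [n, mul_assoc]
    rw [heq, norm_mul, norm_mul, norm_star, hq, one_mul, mul_one, Real.norm_of_nonneg ht.1.le]
    exact hrate t ht

/-! ### The metric in Gaussian null coordinates -/

/-- The vector of the three right-invariant forms. -/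
noncomputable def sigmaVec (x X : ℍ[ℝ]) : Fin 3 → ℝ := fun i => sigma i x X

lemma sigmaVec_eq (x X : ℍ[ℝ]) : sigmaVec x X = (-2 : ℝ) • imVec (X * x⁻¹) := rfl

lemma ds_eq (x X : ℍ[ℝ]) : ds x X = (X * x⁻¹).re := rfl

lemma su2Metric_eq (H : ℝ → Matrix (Fin 3) (Fin 3) ℝ) (y X Y : ℍ[ℝ]) :
    su2Metric H y X Y
      = ds y X * ds y Y + sigmaVec y X ⬝ᵥ (H (Real.log ‖y‖) *ᵥ sigmaVec y Y) := by
  simp [su2Metric, sigmaVec, dotProduct, Matrix.mulVec, Fin.sum_univ_three]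
  ring

lemma su2Form_eq (w : ℝ → Fin 3 → ℝ) (y X : ℍ[ℝ]) :
    su2Form w y X = w (Real.log ‖y‖) ⬝ᵥ sigmaVec y X := rfl

lemma exists_ds_eq_sigmaVec_eq {x : ℍ[ℝ]} (hx : x ≠ 0) (c : ℝ) (a : Fin 3 → ℝ) :
    ∃ X : ℍ[ℝ], ds x X = c ∧ sigmaVec x X = a := by
  refine ⟨((c : ℍ[ℝ]) + ofIm fun i => -a i / 2) * x, ?_, ?_⟩
  · rw [ds_eq, mul_assoc, mul_inv_cancel₀ hx, mul_one]
    simp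
  · rw [sigmaVec_eq, mul_assoc, mul_inv_cancel₀ hx, mul_one]
    ext i
    fin_cases i <;> simp [imVec] <;> ring

lemma sigmaVec_mul_left {q : ℍ[ℝ]} (hq : ‖q‖ = 1) (x X : ℍ[ℝ]) :
    sigmaVec (q * x) (q * X) = rot q *ᵥ sigmaVec x X := by
  have h : q * X * (q * x)⁻¹ = q * (X * x⁻¹) * star q := by
    rw [mul_inv_rev, inv_eq_star_of_norm_eq_one hq]; simp only [mul_assoc]
  rw [sigmaVec_eq, h, imVec_conj, sigmaVec_eq, Matrix.mulVec_smul]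

lemma re_conj {q : ℍ[ℝ]} (hq : ‖q‖ = 1) (x : ℍ[ℝ]) : (q * x * star q).re = x.re := by
  have h := norm_eq_one_iff.1 hq
  simp
  linear_combination x.re * h

namespace GNC

variable (D : GNC)

lemma metric_eq_dotProduct (p X Y : ℝ × ℍ[ℝ]) :
    D.metric p X Y = X.1 * ds p.2 Y.2 + Y.1 * ds p.2 X.2
      - Real.log ‖p.2‖ ^ 2 * D.Del (Real.log ‖p.2‖) ^ 2 * X.1 * Y.1
      + Real.log ‖p.2‖ * (D.hor (Real.log ‖p.2‖) ⬝ᵥ sigmaVec p.2 X.2 * Y.1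
        + D.hor (Real.log ‖p.2‖) ⬝ᵥ sigmaVec p.2 Y.2 * X.1)
      + sigmaVec p.2 X.2 ⬝ᵥ (D.gam (Real.log ‖p.2‖) *ᵥ sigmaVec p.2 Y.2) := by
  simp [metric, sigmaVec, dotProduct, Matrix.mulVec, Fin.sum_univ_three]
  ring

/-! ### The near-horizon geometry -/

/-- The values at the horizon that the `U(1)` symmetry allows. It is enough to rotate by a right
angle. -/
lemma IsU1Invariant.hor_gam (hNH : D.nearHorizon.IsU1Invariant) :
    D.hor 0 0 = 0 ∧ D.hor 0 1 = 0 ∧ D.gam 0 0 0 = D.gam 0 1 1 ∧ D.gam 0 0 1 + D.gam 0 1 0 = 0 ∧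
      D.gam 0 0 2 = 0 ∧ D.gam 0 1 2 = 0 ∧ D.gam 0 2 0 = 0 ∧ D.gam 0 2 1 = 0 := by
  set x : ℍ[ℝ] := ((Real.exp 1 : ℝ) : ℍ[ℝ]) with hx_def
  have hnorm : ‖x‖ = Real.exp 1 := by simp [hx_def]
  have hx : x ≠ 0 := norm_pos_iff.1 (by rw [hnorm]; positivity)
  have hlog : Real.log ‖x‖ = 1 := by rw [hnorm, Real.log_exp]
  set q : ℍ[ℝ] := ⟨Real.cos (Real.pi / 4), 0, 0, Real.sin (Real.pi / 4)⟩ with hq_def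
  have hq : ‖q‖ = 1 := norm_eq_one_iff.2 (by simp [hq_def]; norm_num [div_pow])
  have hrot : rot q = !![0, -1, 0; 1, 0, 0; 0, 0, 1] := by
    have h2 : √2 * √2 = 2 := Real.mul_self_sqrt (by norm_num)
    ext i j
    fin_cases i <;> fin_cases j <;> simp [rot, hq_def, div_pow] <;> linarith
  have key := fun X Y => hNH (Real.pi / 4) (0, x) hx X Y
  simp only [← hq_def, metric_eq_dotProduct, norm_mul, hq, one_mul, hlog, nearHorizon, hrot,
    sigmaVec_mul_left hq] at key
  have hds : ∀ X, ds (q * x) (q * X) = ds x X := fun X => by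
    rw [ds_eq, mul_inv_rev, inv_eq_star_of_norm_eq_one hq, ds_eq, ← re_conj hq (X * x⁻¹)]
    simp only [mul_assoc]
  simp only [hds] at key
  have hv : ∀ a : Fin 3 → ℝ, D.hor 0 ⬝ᵥ (!![0, -1, 0; 1, 0, 0; 0, 0, 1] *ᵥ a) = D.hor 0 ⬝ᵥ a := by
    intro a
    obtain ⟨A, -, hA⟩ := exists_ds_eq_sigmaVec_eq hx 0 a
    have h0 : sigmaVec x 0 = 0 := by
      rw [sigmaVec_eq, zero_mul]; ext i; fin_cases i <;> simp [imVec]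
    have := key (1, 0) (0, A)
    simpa [hA, h0] using this
  have hg : ∀ a b : Fin 3 → ℝ, (!![0, -1, 0; 1, 0, 0; 0, 0, 1] *ᵥ a) ⬝ᵥ
      (D.gam 0 *ᵥ (!![0, -1, 0; 1, 0, 0; 0, 0, 1] *ᵥ b)) = a ⬝ᵥ (D.gam 0 *ᵥ b) := by
    intro a b
    obtain ⟨A, -, hA⟩ := exists_ds_eq_sigmaVec_eq hx 0 a
    obtain ⟨B, -, hB⟩ := exists_ds_eq_sigmaVec_eq hx 0 b
    have := key (0, A) (0, B)
    simpa [hA, hB] using this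
  have v0 := hv ![1, 0, 0]
  have v1 := hv ![0, 1, 0]
  have g00 := hg ![1, 0, 0] ![1, 0, 0]
  have g01 := hg ![1, 0, 0] ![0, 1, 0]
  have g02 := hg ![1, 0, 0] ![0, 0, 1]
  have g12 := hg ![0, 1, 0] ![0, 0, 1]
  have g20 := hg ![0, 0, 1] ![1, 0, 0]
  have g21 := hg ![0, 0, 1] ![0, 1, 0]
  simp [Matrix.mulVec, dotProduct, Fin.sum_univ_three]
    at v0 v1 g00 g01 g02 g12 g20 g21
  refine ⟨?_, ?_, ?_, ?_, ?_, ?_, ?_, ?_⟩ <;> linarith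

/-! ### The base metric -/

/-- `Δ² + hᵢ hⁱ` on the slice of constant `lam`. -/
noncomputable def normSq (l : ℝ) : ℝ := D.Del l ^ 2 + D.hor l ⬝ᵥ ((D.gam l)⁻¹ *ᵥ D.hor l)

/-- The vector `hⁱ / (Δ² + hₖ hᵏ)`. The base metric is diagonalised by
`σᵢ + shiftᵢ dlam / lam`. -/
noncomputable def shift (l : ℝ) : Fin 3 → ℝ := (D.normSq l)⁻¹ • ((D.gam l)⁻¹ *ᵥ D.hor l)

/-- The matrix `γᵢⱼ + hᵢ hⱼ / Δ²`, to which the base metric on the slices is proportional. -/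
noncomputable def baseMat (l : ℝ) : Matrix (Fin 3) (Fin 3) ℝ :=
  D.gam l + (D.Del l ^ 2)⁻¹ • Matrix.vecMulVec (D.hor l) (D.hor l)

lemma nhNorm_eq : D.nhNorm = D.normSq 0 := rfl

lemma coneMetric_eq : D.coneMetric = D.coneF • D.baseMat 0 := by
  ext i j
  simp only [coneMetric, coneF, baseMat, Matrix.vecMulVec_apply, Matrix.of_apply, Matrix.smul_apply,
    Matrix.add_apply, smul_eq_mul]
  ring

variable {D} {l : ℝ}

lemma normSq_pos (hg : (D.gam l).PosDef) (hD : 0 < D.Del l) : 0 < D.normSq l := by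
  have h := hg.inv.posSemidef.dotProduct_mulVec_nonneg (D.hor l)
  simp only [star_trivial] at h
  unfold normSq
  positivity

lemma baseMat_posDef (hg : (D.gam l).PosDef) : (D.baseMat l).PosDef := by
  refine hg.add_posSemidef (Matrix.PosSemidef.smul ?_ (by positivity))
  simpa using Matrix.posSemidef_vecMulVec_self_star (D.hor l)

lemma hor_dotProduct_shift (hN : D.normSq l ≠ 0) :
    D.hor l ⬝ᵥ D.shift l = 1 - D.Del l ^ 2 / D.normSq l := by
  rw [shift, dotProduct_smul, smul_eq_mul]
  have : D.hor l ⬝ᵥ ((D.gam l)⁻¹ *ᵥ D.hor l) = D.normSq l - D.Del l ^ 2 := by simp [normSq]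
  rw [this]
  field_simp

lemma baseMat_mulVec_shift (hg : (D.gam l).PosDef) (hD : 0 < D.Del l) :
    D.baseMat l *ᵥ D.shift l = (D.Del l ^ 2)⁻¹ • D.hor l := by
  have hN := (normSq_pos hg hD).ne'
  have hdet : IsUnit (D.gam l).det := hg.det_pos.ne'.isUnit
  have h1 : D.gam l *ᵥ D.shift l = (D.normSq l)⁻¹ • D.hor l := by
    rw [shift, Matrix.mulVec_smul, Matrix.mulVec_mulVec, Matrix.mul_nonsing_inv _ hdet,
      Matrix.one_mulVec]
  have h2 : Matrix.vecMulVec (D.hor l) (D.hor l) *ᵥ D.shift l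
      = (D.hor l ⬝ᵥ D.shift l) • D.hor l := by
    ext i
    simp [Matrix.mulVec, Matrix.vecMulVec_apply, dotProduct, Fin.sum_univ_three]
    ring
  rw [baseMat, Matrix.add_mulVec, Matrix.smul_mulVec, h1, h2, hor_dotProduct_shift hN, smul_smul,
    ← add_smul]
  congr 1
  field_simp
  ring

lemma dotProduct_baseMat_mulVec (a b : Fin 3 → ℝ) :
    a ⬝ᵥ (D.baseMat l *ᵥ b) = a ⬝ᵥ (D.gam l *ᵥ b)
      + (D.Del l ^ 2)⁻¹ * ((D.hor l ⬝ᵥ a) * (D.hor l ⬝ᵥ b)) := by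
  simp [baseMat, Matrix.mulVec, Matrix.vecMulVec_apply, dotProduct, Fin.sum_univ_three]
  ring

lemma baseMat_transpose (hg : (D.gam l).PosDef) : (D.baseMat l)ᵀ = D.baseMat l := by
  simpa using (baseMat_posDef hg).isHermitian.eq

/-- Completing the square in the base metric. -/
lemma base_metric_eq (hg : (D.gam l).PosDef) (hD : 0 < D.Del l) (hl : 0 < l) (s t : ℝ)
    (a b : Fin 3 → ℝ) :
    l * D.Del l * (a ⬝ᵥ (D.gam l *ᵥ b))
        + (s + l * D.hor l ⬝ᵥ a) * (t + l * D.hor l ⬝ᵥ b) / (l * D.Del l)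
      = D.Del l / (l * D.normSq l) * (s * t)
        + l * D.Del l * ((a + (s / l) • D.shift l) ⬝ᵥ (D.baseMat l *ᵥ (b + (t / l) • D.shift l))) := by
  have hN := (normSq_pos hg hD).ne'
  have h1 : ∀ c : Fin 3 → ℝ, D.shift l ⬝ᵥ (D.baseMat l *ᵥ c) = (D.Del l ^ 2)⁻¹ * D.hor l ⬝ᵥ c := by
    intro c
    rw [Matrix.dotProduct_mulVec, ← Matrix.mulVec_transpose, baseMat_transpose hg,
      baseMat_mulVec_shift hg hD, smul_dotProduct, smul_eq_mul]
  have h2 : a ⬝ᵥ (D.baseMat l *ᵥ D.shift l) = (D.Del l ^ 2)⁻¹ * D.hor l ⬝ᵥ a := by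
    rw [baseMat_mulVec_shift hg hD, dotProduct_smul, smul_eq_mul, dotProduct_comm]
  rw [Matrix.mulVec_add, Matrix.mulVec_smul, add_dotProduct, dotProduct_add, dotProduct_add,
    smul_dotProduct, smul_dotProduct, dotProduct_smul, dotProduct_smul, h1, h1, h2,
    dotProduct_baseMat_mulVec, hor_dotProduct_shift hN]
  simp only [smul_eq_mul]
  field_simp
  ring

end GNC

/-! ### Smoothness of the horizon data -/

lemma contDiffOn_det {n : ℕ} {M : ℝ → Matrix (Fin n) (Fin n) ℝ} {U : Set ℝ}
    (hM : ∀ i j, ContDiffOn ℝ ∞ (fun t => M t i j) U) : ContDiffOn ℝ ∞ (fun t => (M t).det) U := by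
  simp only [Matrix.det_apply]
  exact ContDiffOn.sum fun σ _ => (contDiffOn_prod fun i _ => hM _ _).const_smul _

lemma contDiffOn_inv_apply {n : ℕ} {M : ℝ → Matrix (Fin n) (Fin n) ℝ} {U : Set ℝ}
    (hM : ∀ i j, ContDiffOn ℝ ∞ (fun t => M t i j) U) (hdet : ∀ t ∈ U, (M t).det ≠ 0) (i j : Fin n) :
    ContDiffOn ℝ ∞ (fun t => (M t)⁻¹ i j) U := by
  simp only [Matrix.inv_def, Ring.inverse_eq_inv', Matrix.smul_apply, smul_eq_mul,
    Matrix.adjugate_apply]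
  refine ((contDiffOn_det hM).inv hdet).mul (contDiffOn_det fun i' j' => ?_)
  simp only [Matrix.updateRow_apply]
  split_ifs
  · exact contDiffOn_const
  · exact hM _ _

lemma contDiffOn_dotProduct {u w : ℝ → Fin 3 → ℝ} {U : Set ℝ}
    (hu : ∀ i, ContDiffOn ℝ ∞ (fun t => u t i) U) (hw : ∀ i, ContDiffOn ℝ ∞ (fun t => w t i) U) :
    ContDiffOn ℝ ∞ (fun t => u t ⬝ᵥ w t) U :=
  ContDiffOn.sum fun i _ => (hu i).mul (hw i)

namespace GNC

variable {D : GNC} {U : Set ℝ}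

lemma contDiffOn_inv_mulVec (hh : ∀ i, ContDiffOn ℝ ∞ (fun l => D.hor l i) U)
    (hg : ∀ i j, ContDiffOn ℝ ∞ (fun l => D.gam l i j) U) (hpos : ∀ l ∈ U, (D.gam l).PosDef)
    (i : Fin 3) : ContDiffOn ℝ ∞ (fun l => ((D.gam l)⁻¹ *ᵥ D.hor l) i) U :=
  contDiffOn_dotProduct
    (contDiffOn_inv_apply hg (fun l hl => (hpos l hl).det_pos.ne') i) hh

lemma contDiffOn_normSq (hDel : ContDiffOn ℝ ∞ D.Del U)
    (hh : ∀ i, ContDiffOn ℝ ∞ (fun l => D.hor l i) U)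
    (hg : ∀ i j, ContDiffOn ℝ ∞ (fun l => D.gam l i j) U) (hpos : ∀ l ∈ U, (D.gam l).PosDef) :
    ContDiffOn ℝ ∞ D.normSq U :=
  (hDel.pow 2).add (contDiffOn_dotProduct hh (contDiffOn_inv_mulVec hh hg hpos))

lemma contDiffOn_shift (hDel : ContDiffOn ℝ ∞ D.Del U)
    (hh : ∀ i, ContDiffOn ℝ ∞ (fun l => D.hor l i) U)
    (hg : ∀ i j, ContDiffOn ℝ ∞ (fun l => D.gam l i j) U) (hpos : ∀ l ∈ U, (D.gam l).PosDef)
    (hDpos : ∀ l ∈ U, 0 < D.Del l) (i : Fin 3) : ContDiffOn ℝ ∞ (fun l => D.shift l i) U :=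
  ((contDiffOn_normSq hDel hh hg hpos).inv
    fun l hl => (normSq_pos (hpos l hl) (hDpos l hl)).ne').mul (contDiffOn_inv_mulVec hh hg hpos i)

lemma contDiffOn_baseMat (hDel : ContDiffOn ℝ ∞ D.Del U)
    (hh : ∀ i, ContDiffOn ℝ ∞ (fun l => D.hor l i) U)
    (hg : ∀ i j, ContDiffOn ℝ ∞ (fun l => D.gam l i j) U)
    (hDpos : ∀ l ∈ U, 0 < D.Del l) (i j : Fin 3) :
    ContDiffOn ℝ ∞ (fun l => D.baseMat l i j) U :=
  (hg i j).add (((hDel.pow 2).inv fun l hl => by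
    have := hDpos l hl; positivity).mul ((hh i).mul (hh j)))

end GNC

/-! ### The radial coordinate -/

/-- The square `Q` of the arc length `∫ q(μ) μ^(-1/2) dμ` from `0` is a smooth coordinate, also
across `0`: the arc length is `√t T(t)` with the smooth function `T(t) = ∫₀¹ 2 q(t s²) ds`. -/
lemma exists_radial {q : ℝ → ℝ} {a b : ℝ} (ha : a < 0) (hb : 0 < b)
    (hq : ContDiffOn ℝ ∞ q (Ioo a b)) (hpos : ∀ t ∈ Ioo a b, 0 < q t) :
    ∃ Q : ℝ → ℝ, ContDiffOn ℝ ∞ Q (Ioo a b) ∧ (∀ t ∈ Ioo a b, 0 < deriv Q t) ∧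
      Q 0 = 0 ∧ deriv Q 0 = 4 * q 0 ^ 2 ∧
      ∀ t ∈ Ioo 0 b, 0 < Q t ∧ HasDerivAt (fun t => √(Q t)) (q t / √t) t := by
  let T : ℝ → ℝ := fun t => 2 * ∫ s in (0 : ℝ)..1, s ^ 0 * q (t * s ^ 2)
  have hT : ContDiffOn ℝ ∞ T (Ioo a b) := contDiffOn_const.mul <| contDiffOn_infty.2 fun n =>
    contDiffOn_integral_pow_mul_comp_mul_sq ha hb n q hq 0
  have hq1 : ContDiffOn ℝ 1 q (Ioo a b) := hq.of_le (mod_cast le_top)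
  have hTd : ∀ t ∈ Ioo a b, HasDerivAt T
      (2 * ∫ s in (0 : ℝ)..1, s ^ 2 * deriv q (t * s ^ 2)) t := fun t ht => by
    exact (hasDerivAt_integral_pow_mul_comp_mul_sq ha hb hq1 0 ht).const_mul 2
  have hcq : ∀ t ∈ Ioo a b, ContinuousOn (fun s : ℝ => q (t * s ^ 2)) (uIcc 0 1) := fun t ht =>
    hq.continuousOn.comp (by fun_prop) fun s hs =>
      mul_sq_mem_Ioo ha hb ht (by rwa [uIcc_of_le zero_le_one] at hs)
  have hcq' : ∀ t ∈ Ioo a b, ContinuousOn (fun s : ℝ => deriv q (t * s ^ 2)) (uIcc 0 1) :=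
    fun t ht => (hq1.continuousOn_deriv_of_isOpen isOpen_Ioo le_rfl).comp (by fun_prop) fun s hs =>
      mul_sq_mem_Ioo ha hb ht (by rwa [uIcc_of_le zero_le_one] at hs)
  have hTpos : ∀ t ∈ Ioo a b, 0 < T t := fun t ht => by
    refine mul_pos two_pos (intervalIntegral.intervalIntegral_pos_of_pos_on ?_ ?_ one_pos)
    · simpa using (hcq t ht).intervalIntegrable
    · intro s hs
      simpa using hpos _ (mul_sq_mem_Ioo ha hb ht (Ioo_subset_Icc_self hs))
  -- integration by parts: `T + 2 t T' = 2 q`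
  have hTeq : ∀ t ∈ Ioo a b, T t + 2 * t * deriv T t = 2 * q t := fun t ht => by
    have hderiv : ∀ s ∈ uIcc (0 : ℝ) 1, HasDerivAt (fun s => s * q (t * s ^ 2))
        (s ^ 0 * q (t * s ^ 2) + 2 * t * (s ^ 2 * deriv q (t * s ^ 2))) s := fun s hs => by
      rw [uIcc_of_le zero_le_one] at hs
      have h1 : HasDerivAt q (deriv q (t * s ^ 2)) (t * s ^ 2) :=
        ((hq1.differentiableOn one_ne_zero).differentiableAt
          (isOpen_Ioo.mem_nhds (mul_sq_mem_Ioo ha hb ht hs))).hasDerivAt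
      have h2 : HasDerivAt (fun s : ℝ => t * s ^ 2) (t * (2 * s)) s := by
        simpa using (hasDerivAt_pow 2 s).const_mul t
      exact ((hasDerivAt_id s).mul (h1.comp s h2)).congr_deriv (by simp; ring)
    have hi1 : IntervalIntegrable (fun s : ℝ => s ^ 0 * q (t * s ^ 2)) MeasureTheory.volume 0 1 := by
      simpa using (hcq t ht).intervalIntegrable
    have hi2 : IntervalIntegrable (fun s : ℝ => 2 * t * (s ^ 2 * deriv q (t * s ^ 2)))
        MeasureTheory.volume 0 1 :=
      (continuousOn_const.mul ((continuousOn_pow 2).mul (hcq' t ht))).intervalIntegrable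
    have h := intervalIntegral.integral_eq_sub_of_hasDerivAt hderiv (hi1.add hi2)
    rw [intervalIntegral.integral_add hi1 hi2, intervalIntegral.integral_const_mul] at h
    simp only [T, (hTd t ht).deriv]
    simp only [one_pow, mul_one, zero_mul, sub_zero, one_mul] at h
    linear_combination 2 * h
  have h0 : (0 : ℝ) ∈ Ioo a b := ⟨ha, hb⟩
  have hT0 : T 0 = 2 * q 0 := by simpa using hTeq 0 h0
  let Q : ℝ → ℝ := fun t => t * T t ^ 2
  have hQd : ∀ t ∈ Ioo a b, HasDerivAt Q (2 * T t * q t) t := fun t ht => by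
    have h1 : HasDerivAt T (deriv T t) t := (hTd t ht).differentiableAt.hasDerivAt
    refine ((hasDerivAt_id t).mul (h1.pow 2)).congr_deriv ?_
    simp
    linear_combination T t * hTeq t ht
  refine ⟨Q, contDiffOn_id.mul (hT.pow 2), fun t ht => ?_, by simp [Q], ?_, fun t ht => ?_⟩
  · rw [(hQd t ht).deriv]
    have := hTpos t ht
    have := hpos t ht
    positivity
  · rw [(hQd 0 h0).deriv, hT0]; ring
  · have ht' : t ∈ Ioo a b := ⟨ha.trans ht.1, ht.2⟩
    have hTt := hTpos t ht'
    have ht0 : 0 < t := ht.1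
    have hQt : 0 < Q t := by positivity
    refine ⟨hQt, ((hQd t ht').sqrt hQt.ne').congr_deriv ?_⟩
    have hs : √(Q t) = √t * T t := by
      simp only [Q]
      rw [Real.sqrt_mul ht0.le, Real.sqrt_sq hTt.le]
    rw [hs]
    field_simp

/-! ### Equivariant coordinate changes -/

/-- The differential of `log ‖x‖`. -/
lemma hasFDerivAt_log_norm {x : ℍ[ℝ]} (hx : x ≠ 0) :
    ∃ d : ℍ[ℝ] →L[ℝ] ℝ, (∀ X, d X = ds x X) ∧ HasFDerivAt (fun x => Real.log ‖x‖) d x := by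
  have hn : ‖x‖ ^ 2 ≠ 0 := pow_ne_zero 2 (norm_ne_zero_iff.2 hx)
  have h := (((hasStrictFDerivAt_norm_sq x).hasFDerivAt.log hn).const_mul (1 / 2 : ℝ))
  refine ⟨_, fun X => ?_, h.congr_of_eventuallyEq (.of_forall fun y => ?_)⟩
  · rw [ds_eq, Quaternion.inv_def]
    simp [Quaternion.inner_def, Quaternion.normSq_eq_norm_mul_self]
    field_simp
  · simp

lemma contDiffAt_log_norm {x : ℍ[ℝ]} (hx : x ≠ 0) :
    ContDiffAt ℝ ∞ (fun x : ℍ[ℝ] => Real.log ‖x‖) x :=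
  (contDiffAt_norm ℝ hx).log (norm_ne_zero_iff.2 hx)

lemma isOpen_cyl {I : Set ℝ} (hI : IsOpen I) : IsOpen (cyl I) := by
  refine isOpen_iff_mem_nhds.2 fun x hx => ?_
  filter_upwards [isOpen_ne.mem_nhds hx.1,
    (contDiffAt_log_norm hx.1).continuousAt.preimage_mem_nhds (hI.mem_nhds hx.2)] with y h1 h2
  exact ⟨h1, h2⟩

lemma contDiffOn_comp_log_norm_mul {I : Set ℝ} {g : ℝ → ℍ[ℝ]}
    (hg : ContDiffOn ℝ ∞ g I) : ContDiffOn ℝ ∞ (fun x => g (Real.log ‖x‖) * x) (cyl I) :=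
  (hg.comp (fun _ hx => (contDiffAt_log_norm hx.1).contDiffWithinAt) fun _ hx => hx.2).mul
    contDiffOn_id

/-- Left multiplication by a quaternion that depends on `‖x‖` only is a diffeomorphism, provided
that the induced change of the radial coordinate is one. -/
lemma exists_coordChange {I R : Set ℝ} (hI : IsOpen I) (hR : IsOpen R) {g : ℝ → ℍ[ℝ]}
    {ρ Λ : ℝ → ℝ} (hg : ContDiffOn ℝ ∞ g I) (hΛ : ContDiffOn ℝ ∞ Λ R)
    (hρI : ∀ l ∈ I, ρ l ∈ R ∧ Λ (ρ l) = l) (hΛR : ∀ r ∈ R, Λ r ∈ I ∧ ρ (Λ r) = r)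
    (hnorm : ∀ l ∈ I, ‖g l‖ = Real.exp (ρ l - l)) :
    ∃ Ψ : OpenPartialHomeomorph ℍ[ℝ] ℍ[ℝ], Ψ.source = cyl I ∧ Ψ.target = cyl R ∧
      (∀ x, Ψ x = g (Real.log ‖x‖) * x) ∧ ContDiffOn ℝ ∞ Ψ Ψ.source ∧
      ContDiffOn ℝ ∞ Ψ.symm Ψ.target ∧
      ∀ x ∈ cyl I, Real.log ‖Ψ x‖ = ρ (Real.log ‖x‖) := by
  have hg0 : ∀ l ∈ I, g l ≠ 0 := fun l hl => norm_pos_iff.1 (by rw [hnorm l hl]; positivity)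
  have hlog : ∀ x ∈ cyl I, Real.log ‖g (Real.log ‖x‖) * x‖ = ρ (Real.log ‖x‖) := fun x hx => by
    rw [norm_mul, Real.log_mul (norm_ne_zero_iff.2 (hg0 _ hx.2)) (norm_ne_zero_iff.2 hx.1),
      hnorm _ hx.2, Real.log_exp]
    ring
  have hlog' : ∀ y ∈ cyl R, Real.log ‖(g (Λ (Real.log ‖y‖)))⁻¹ * y‖ = Λ (Real.log ‖y‖) :=
    fun y hy => by
    have h := hΛR _ hy.2
    rw [norm_mul, norm_inv, Real.log_mul (inv_ne_zero (norm_ne_zero_iff.2 (hg0 _ h.1)))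
      (norm_ne_zero_iff.2 hy.1), Real.log_inv, hnorm _ h.1, Real.log_exp, h.2]
    ring
  have hs : ContDiffOn ℝ ∞ (fun x => g (Real.log ‖x‖) * x) (cyl I) :=
    contDiffOn_comp_log_norm_mul hg
  have hs' : ContDiffOn ℝ ∞ (fun y => (g (Λ (Real.log ‖y‖)))⁻¹ * y) (cyl R) :=
    contDiffOn_comp_log_norm_mul (g := fun r => (g (Λ r))⁻¹) fun r hr => by
      have h1 : ContDiffWithinAt ℝ ∞ (fun r => g (Λ r)) R r :=
        hg.comp hΛ (fun r hr => (hΛR r hr).1) r hr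
      have h2 : ContDiffAt ℝ ∞ Ring.inverse (g (Λ r)) :=
        contDiffAt_ringInverse ℝ (Units.mk0 _ (hg0 _ (hΛR r hr).1))
      rw [Ring.inverse_eq_inv'] at h2
      exact h2.comp_contDiffWithinAt r h1
  refine ⟨{ toFun := fun x => g (Real.log ‖x‖) * x
            invFun := fun y => (g (Λ (Real.log ‖y‖)))⁻¹ * y
            source := cyl I
            target := cyl R
            map_source' := fun x hx => ⟨mul_ne_zero (hg0 _ hx.2) hx.1, ?_⟩
            map_target' := fun y hy =>
              ⟨mul_ne_zero (inv_ne_zero (hg0 _ (hΛR _ hy.2).1)) hy.1, ?_⟩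
            left_inv' := fun x hx => ?_
            right_inv' := fun y hy => ?_
            open_source := isOpen_cyl hI
            open_target := isOpen_cyl hR
            continuousOn_toFun := hs.continuousOn
            continuousOn_invFun := hs'.continuousOn },
          rfl, rfl, fun x => rfl, hs, hs', hlog⟩
  · rw [hlog x hx]; exact (hρI _ hx.2).1
  · rw [hlog' y hy]; exact (hΛR _ hy.2).1
  · rw [hlog x hx, (hρI _ hx.2).2, ← mul_assoc, inv_mul_cancel₀ (hg0 _ hx.2), one_mul]
  · rw [hlog' y hy, ← mul_assoc, mul_inv_cancel₀ (hg0 _ (hΛR _ hy.2).1), one_mul]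

/-- The pullback of the Maurer-Cartan form under `x ↦ exp (ρ - lam) k x`, with `lam = log ‖x‖` and
`k' = k B` for the generator `B` of the shift `v`. -/
lemma maurerCartan_twist {ρ : ℝ → ℝ} {k : ℝ → ℍ[ℝ]} {v : ℝ → Fin 3 → ℝ} {ρ' : ℝ} {x : ℍ[ℝ]}
    (hx : x ≠ 0) (hρ : HasDerivAt ρ ρ' (Real.log ‖x‖))
    (hk : HasDerivAt k (k (Real.log ‖x‖) * shiftGen v (Real.log ‖x‖)) (Real.log ‖x‖))
    (hk1 : ‖k (Real.log ‖x‖)‖ = 1) {Ψ : ℍ[ℝ] → ℍ[ℝ]}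
    (hΨ : ∀ x, Ψ x = (Real.exp (ρ (Real.log ‖x‖) - Real.log ‖x‖) • k (Real.log ‖x‖)) * x)
    (X : ℍ[ℝ]) :
    ds (Ψ x) (fderiv ℝ Ψ x X) = ρ' * ds x X ∧
      sigmaVec (Ψ x) (fderiv ℝ Ψ x X) = rot (k (Real.log ‖x‖)) *ᵥ
        (sigmaVec x X + (ds x X / Real.log ‖x‖) • v (Real.log ‖x‖)) := by
  obtain ⟨d, hd, hlog⟩ := hasFDerivAt_log_norm hx
  set l := Real.log ‖x‖ with hl
  have hexp : HasDerivAt (fun l => Real.exp (ρ l - l)) (Real.exp (ρ l - l) * (ρ' - 1)) l :=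
    (hρ.sub (hasDerivAt_id l)).exp
  have hg := (hexp.smul hk).hasFDerivAt.comp x hlog
  have hF := hg.mul' (hasFDerivAt_id x)
  have hF' : HasFDerivAt Ψ _ x := hF.congr_of_eventuallyEq (.of_forall hΨ)
  have hfd : fderiv ℝ Ψ x X = Real.exp (ρ l - l) • (k l *
      (ds x X • (shiftGen v l * x) + (ds x X * (ρ' - 1)) • x + X)) := by
    rw [hF'.fderiv]
    simp only [add_apply, smul_apply, Function.comp_apply,
      Pi.smul_apply', ContinuousLinearMap.id_apply, ContinuousLinearMap.comp_apply, hd, ← hl,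
      ContinuousLinearMap.toSpanSingleton_apply, MulOpposite.smul_eq_mul_unop, MulOpposite.unop_op,
      smul_eq_mul, id, mul_add, add_mul, smul_mul_assoc, mul_smul_comm, mul_assoc]
    module
  have hΨinv : (Ψ x)⁻¹ = (Real.exp (ρ l - l))⁻¹ • (x⁻¹ * star (k l)) := by
    rw [hΨ, ← hl, smul_mul_assoc, smul_inv₀, mul_inv_rev, inv_eq_star_of_norm_eq_one hk1]
  have hmc : fderiv ℝ Ψ x X * (Ψ x)⁻¹ = ((ds x X * (ρ' - 1) : ℝ) : ℍ[ℝ])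
      + k l * (ds x X • shiftGen v l + X * x⁻¹) * star (k l) := by
    have hE := Real.exp_ne_zero (ρ l - l)
    rw [hfd, hΨinv, smul_mul_smul_comm, mul_inv_cancel₀ hE, one_smul]
    calc k l * (ds x X • (shiftGen v l * x) + (ds x X * (ρ' - 1)) • x + X) * (x⁻¹ * star (k l))
        = k l * (ds x X • (shiftGen v l * (x * x⁻¹)) + (ds x X * (ρ' - 1)) • (x * x⁻¹)
            + X * x⁻¹) * star (k l) := by
          simp only [mul_add, add_mul, smul_mul_assoc, mul_smul_comm, mul_assoc]
      _ = (ds x X * (ρ' - 1)) • (k l * star (k l))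
            + k l * (ds x X • shiftGen v l + X * x⁻¹) * star (k l) := by
          rw [mul_inv_cancel₀ hx]
          simp only [mul_add, add_mul, smul_mul_assoc, mul_smul_comm, mul_assoc, mul_one]
          abel
      _ = _ := by
          rw [mul_star_of_norm_eq_one hk1]
          congr 1
          ext <;> simp
  constructor
  · rw [ds_eq, hmc, Quaternion.re_add, re_conj hk1]
    simp [shiftGen, ds_eq]
    ring
  · rw [sigmaVec_eq, hmc]
    have h1 : ∀ (c : ℝ) (y : ℍ[ℝ]), imVec ((c : ℍ[ℝ]) + y) = imVec y := fun c y => by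
      ext i; fin_cases i <;> simp [imVec]
    rw [h1, imVec_conj, ← Matrix.mulVec_smul]
    congr 1
    ext i
    fin_cases i <;> simp [imVec, sigmaVec, sigma, shiftGen] <;> field_simp <;> ring

/-! ### The base data in Gaussian null coordinates -/

/-- Comparison of the two forms of the metric on `∂_v`, and on pairs with `∂_v`, determines `f` and
`ω`; the rest is `h`. -/
lemma IsTimelikeSusy.base_eq {ℓ lp : ℝ} {D : GNC} {F : Tensor2 (ℝ × ℍ[ℝ])} {f : ℍ[ℝ] → ℝ}
    {om : OneForm ℍ[ℝ]} {h J : Tensor2 ℍ[ℝ]}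
    (hsusy : IsTimelikeSusy ℓ (cyl (Ioo 0 lp)) D.metric F f om h J)
    (hDel : ∀ l ∈ Ioo 0 lp, 0 < D.Del l) {x : ℍ[ℝ]} (hx : x ∈ cyl (Ioo 0 lp)) {l : ℝ}
    (hl : Real.log ‖x‖ = l) :
    f x = l * D.Del l ∧
    (∀ X, om x X = -(ds x X + l * D.hor l ⬝ᵥ sigmaVec x X) / (l * D.Del l) ^ 2) ∧
    ∀ X Y, h x X Y = l * D.Del l * (sigmaVec x X ⬝ᵥ (D.gam l *ᵥ sigmaVec x Y))
      + (ds x X + l * D.hor l ⬝ᵥ sigmaVec x X) * (ds x Y + l * D.hor l ⬝ᵥ sigmaVec x Y)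
        / (l * D.Del l) := by
  have hlI : l ∈ Ioo 0 lp := hl ▸ hx.2
  have hl0 : 0 < l := hlI.1
  have hD0 := hDel l hlI
  have hfpos := hsusy.f_pos x hx
  have key := fun X Y => hsusy.metric_eq (0, x) hx X Y
  simp only [GNC.metric_eq_dotProduct, hl] at key
  have hds0 : ds x 0 = 0 := by simp [ds]
  have hsig0 : sigmaVec x 0 = 0 := by
    rw [sigmaVec_eq, zero_mul]; ext i; fin_cases i <;> simp [imVec]
  have hf : f x = l * D.Del l := by
    have h1 := key (1, 0) (1, 0)
    simp only [hds0, hsig0, map_zero, dotProduct_zero, zero_dotProduct] at h1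
    have h2 : f x ^ 2 = (l * D.Del l) ^ 2 := by linear_combination h1
    exact (pow_left_inj₀ hfpos.le (by positivity) two_ne_zero).1 h2
  have hom : ∀ X, om x X = -(ds x X + l * D.hor l ⬝ᵥ sigmaVec x X) / (l * D.Del l) ^ 2 := by
    intro X
    have h1 := key (1, 0) (0, X)
    simp only [hds0, hsig0, map_zero, dotProduct_zero, zero_dotProduct,
      zero_apply, hf] at h1
    rw [eq_div_iff (by positivity)]
    linear_combination h1
  refine ⟨hf, hom, fun X Y => ?_⟩
  have h1 := key (0, X) (0, Y)
  simp only [hom, hf] at h1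
  have h2 : l * D.Del l ≠ 0 := by positivity
  field_simp at h1 ⊢
  linear_combination -h1

/-! ### Asymptotics at the horizon -/

lemma isBigO_rot {K : ℝ → ℍ[ℝ]} (hK : ∀ᶠ r in 𝓝[>] (0 : ℝ), ‖K r‖ = 1) (i j : Fin 3) :
    (fun r => rot (K r) i j) =O[𝓝[>] 0] fun _ => (1 : ℝ) :=
  IsBigO.of_bound 1 (by filter_upwards [hK] with r hr; simpa using abs_rot_le_one hr i j)

lemma isBigO_rot_mulVec {K : ℝ → ℍ[ℝ]} (hK : ∀ᶠ r in 𝓝[>] (0 : ℝ), ‖K r‖ = 1)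
    {V : ℝ → Fin 3 → ℝ} {g : ℝ → ℝ} (hV : ∀ i, (fun r => V r i) =O[𝓝[>] 0] g) (i : Fin 3) :
    (fun r => (rot (K r) *ᵥ V r) i) =O[𝓝[>] 0] g := by
  simp only [Matrix.mulVec, dotProduct]
  exact IsBigO.fun_sum fun j _ => by simpa using (isBigO_rot hK i j).mul (hV j)

lemma isBigO_rot_conj {K : ℝ → ℍ[ℝ]} (hK : ∀ᶠ r in 𝓝[>] (0 : ℝ), ‖K r‖ = 1)
    {M : ℝ → Matrix (Fin 3) (Fin 3) ℝ} {g : ℝ → ℝ}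
    (hM : ∀ i j, (fun r => M r i j) =O[𝓝[>] 0] g) (i j : Fin 3) :
    (fun r => (rot (K r) * M r * (rot (K r))ᵀ) i j) =O[𝓝[>] 0] g := by
  simp_rw [Matrix.mul_apply (M := rot _ * M _), Matrix.transpose_apply]
  refine IsBigO.fun_sum fun m _ => ?_
  have h := (isBigO_rot_mulVec hK (fun i => hM i m) i).mul (isBigO_rot hK j m)
  simp only [mul_one] at h
  exact h

lemma isBigO_rot_axis {K : ℝ → ℍ[ℝ]} {g : ℝ → ℝ}
    (hn : (fun r => K r * e₃ * star (K r) - e₃) =O[𝓝[>] 0] g) (i : Fin 3) :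
    (fun r => (rot (K r) *ᵥ ![0, 0, 1]) i - (![0, 0, 1] : Fin 3 → ℝ) i) =O[𝓝[>] 0] g := by
  refine (IsBigO.of_bound 1 (.of_forall fun r => ?_)).trans hn
  have h : (rot (K r) *ᵥ ![0, 0, 1]) i - (![0, 0, 1] : Fin 3 → ℝ) i
      = imVec (K r * e₃ * star (K r) - e₃) i := by
    rw [rot_mulVec_axis]
    fin_cases i <;> simp [imVec, e₃]
  rw [h, one_mul]
  exact abs_imVec_le_norm _ i

/-- A matrix which tends to an axially symmetric one has the same limit after a rotation which
asymptotically fixes the axis. -/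
lemma isBigO_rot_conj_sub {K : ℝ → ℍ[ℝ]} (hK : ∀ᶠ r in 𝓝[>] (0 : ℝ), ‖K r‖ = 1) {g : ℝ → ℝ}
    (hn : (fun r => K r * e₃ * star (K r) - e₃) =O[𝓝[>] 0] g)
    {M : ℝ → Matrix (Fin 3) (Fin 3) ℝ} {M₀ : Matrix (Fin 3) (Fin 3) ℝ} {α β : ℝ}
    (hM₀ : M₀ = α • 1 + β • Matrix.vecMulVec ![0, 0, 1] ![0, 0, 1])
    (hM : ∀ i j, (fun r => M r i j - M₀ i j) =O[𝓝[>] 0] g) (i j : Fin 3) :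
    (fun r => (rot (K r) * M r * (rot (K r))ᵀ) i j - M₀ i j) =O[𝓝[>] 0] g := by
  set u : Fin 3 → ℝ := ![0, 0, 1] with hu
  have h1 := isBigO_rot_conj hK (M := fun r => M r - M₀) hM i j
  have hd := isBigO_rot_axis hn
  have hb : (fun r => (rot (K r) *ᵥ u) i) =O[𝓝[>] 0] fun _ => (1 : ℝ) :=
    isBigO_rot_mulVec hK (V := fun _ => u) (fun i => isBigO_const_const _ one_ne_zero _) i
  have h2 : (fun r => β * ((rot (K r) *ᵥ u) i * ((rot (K r) *ᵥ u) j - u j)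
      + ((rot (K r) *ᵥ u) i - u i) * u j)) =O[𝓝[>] 0] g := by
    refine IsBigO.const_mul_left (IsBigO.add ?_ ?_) β
    · simpa using hb.mul (hd j)
    · simpa [mul_comm] using (hd i).const_mul_left (u j)
  refine (h1.add h2).congr' ?_ EventuallyEq.rfl
  filter_upwards [hK] with r hr
  have h3 : rot (K r) * M₀ * (rot (K r))ᵀ
      = α • 1 + β • Matrix.vecMulVec (rot (K r) *ᵥ u) (rot (K r) *ᵥ u) := by
    rw [hM₀, Matrix.mul_add, Matrix.add_mul, Matrix.mul_smul, Matrix.smul_mul, Matrix.mul_one,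
      rot_mul_transpose hr, Matrix.mul_smul, Matrix.smul_mul, Matrix.mul_vecMulVec,
      Matrix.vecMulVec_mul, Matrix.vecMul_transpose]
  have h4 : M₀ i j = α * (1 : Matrix (Fin 3) (Fin 3) ℝ) i j + β * (u i * u j) := by
    rw [hM₀]; simp [Matrix.vecMulVec_apply]
  rw [Matrix.mul_sub, Matrix.sub_mul, h3, Matrix.sub_apply, h4]
  simp only [Matrix.add_apply, Matrix.smul_apply, smul_eq_mul, Matrix.vecMulVec_apply]
  ring

/-- A vector which tends to one along the axis has the same limit after a rotation which
asymptotically fixes the axis. -/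
lemma isBigO_rot_mulVec_sub {K : ℝ → ℍ[ℝ]} (hK : ∀ᶠ r in 𝓝[>] (0 : ℝ), ‖K r‖ = 1) {g : ℝ → ℝ}
    (hn : (fun r => K r * e₃ * star (K r) - e₃) =O[𝓝[>] 0] g)
    {V : ℝ → Fin 3 → ℝ} {V₀ : Fin 3 → ℝ} {β : ℝ} (hV₀ : V₀ = β • ![0, 0, 1])
    (hV : ∀ i, (fun r => V r i - V₀ i) =O[𝓝[>] 0] g) (i : Fin 3) :
    (fun r => (rot (K r) *ᵥ V r) i - V₀ i) =O[𝓝[>] 0] g := by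
  have h1 := isBigO_rot_mulVec hK (V := fun r => V r - V₀) hV i
  refine (h1.add ((isBigO_rot_axis hn i).const_mul_left β)).congr_left fun r => ?_
  rw [Matrix.mulVec_sub, Pi.sub_apply, hV₀, Matrix.mulVec_smul]
  simp only [Pi.smul_apply, smul_eq_mul]
  ring

/-! ### The constants of the cone -/

namespace GNC

variable {D : GNC}

lemma baseMat_zero_eq (hNH : D.nearHorizon.IsU1Invariant) (hg : (D.gam 0).PosDef) :
    D.baseMat 0 = D.baseMat 0 0 0 • 1
      + (D.baseMat 0 2 2 - D.baseMat 0 0 0) • Matrix.vecMulVec ![0, 0, 1] ![0, 0, 1] := by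
  obtain ⟨h0, h1, g1, g2, g3, g4, g5, g6⟩ := IsU1Invariant.hor_gam D hNH
  have hsymm : D.gam 0 1 0 = D.gam 0 0 1 := by simpa using hg.isHermitian.apply 0 1
  have g7 : D.gam 0 0 1 = 0 := by linarith
  ext i j
  fin_cases i <;> fin_cases j <;>
    simp [baseMat, Matrix.vecMulVec_apply, h0, h1, g1, g3, g4, g5, g6, g7, hsymm]

lemma hor_zero_eq (hNH : D.nearHorizon.IsU1Invariant) : D.hor 0 = D.hor 0 2 • ![0, 0, 1] := by
  obtain ⟨h0, h1, -⟩ := IsU1Invariant.hor_gam D hNH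
  ext i
  fin_cases i <;> simp [h0, h1]

/-- At the horizon the shift points along the third axis. -/
lemma shift_zero (hNH : D.nearHorizon.IsU1Invariant) (hg : (D.gam 0).PosDef) :
    D.shift 0 0 = 0 ∧ D.shift 0 1 = 0 := by
  obtain ⟨h0, h1, g1, g2, g3, g4, g5, g6⟩ := IsU1Invariant.hor_gam D hNH
  have hsymm : D.gam 0 1 0 = D.gam 0 0 1 := by simpa using hg.isHermitian.apply 0 1
  have g7 : D.gam 0 0 1 = 0 := by linarith
  have g8 : D.gam 0 1 0 = 0 := by rw [hsymm, g7]
  constructor <;> simp [shift, dotProduct, Fin.sum_univ_three, Matrix.inv_def,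
    Matrix.adjugate_fin_three, h0, h1, g3, g4, g5, g6, g7, g8]

lemma coneF_pos (hg : (D.gam 0).PosDef) (hD : 0 < D.Del 0) : 0 < D.coneF :=
  mul_pos (by norm_num) (normSq_pos hg hD)

lemma coneMetric_props (hNH : D.nearHorizon.IsU1Invariant) (hg : (D.gam 0).PosDef)
    (hD : 0 < D.Del 0) :
    D.coneMetric.PosDef ∧ D.coneMetric.IsDiag ∧ D.coneMetric 0 0 = D.coneMetric 1 1 := by
  have hb := baseMat_zero_eq hNH hg
  refine ⟨?_, ?_, ?_⟩
  · rw [coneMetric_eq]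
    exact (baseMat_posDef hg).smul (coneF_pos hg hD)
  · rw [coneMetric_eq, hb]
    intro i j hij
    fin_cases i <;> fin_cases j <;> first | exact absurd rfl hij | simp
  · rw [coneMetric_eq, hb]
    simp

lemma coneOmega_eq (i : Fin 3) : D.coneOmega i = -((D.Del 0 * D.coneF)⁻¹ * D.hor 0 i) := by
  simp only [coneOmega, coneF]
  rw [mul_inv, mul_inv, div_eq_mul_inv, mul_inv]
  ring

end GNC

/-! ### The radial coordinate at the horizon -/

lemma exists_antideriv {u : ℝ → ℝ} {a b : ℝ} (hu : ContDiffOn ℝ ∞ u (Ioo a b)) :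
    ∃ χ : ℝ → ℝ, ContDiffOn ℝ ∞ χ (Ioo a b) ∧ ∀ t ∈ Ioo a b, deriv χ t = u t := by
  have hd : ∀ t ∈ Ioo a b, HasDerivAt (fun t => ∫ s in ((a + b) / 2)..t, u s) (u t) t := by
    intro t ht
    have hmid : (a + b) / 2 ∈ Ioo a b := by
      have := ht.1.trans ht.2
      constructor <;> linarith
    have hsub : uIcc ((a + b) / 2) t ⊆ Ioo a b := ordConnected_Ioo.uIcc_subset hmid ht
    exact intervalIntegral.integral_hasDerivAt_right
      (hu.continuousOn.mono hsub).intervalIntegrable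
      (hu.continuousOn.stronglyMeasurableAtFilter isOpen_Ioo t ht)
      (hu.continuousOn.continuousAt (isOpen_Ioo.mem_nhds ht))
  refine ⟨_, (contDiffOn_infty_iff_deriv_of_isOpen isOpen_Ioo).2
    ⟨fun t ht => (hd t ht).differentiableAt.differentiableWithinAt,
      hu.congr fun t ht => (hd t ht).deriv⟩, fun t ht => (hd t ht).deriv⟩

lemma tendsto_sq_nhdsGT : Tendsto (fun r : ℝ => r ^ 2) (𝓝[>] 0) (𝓝 0) := by
  have h : Tendsto (fun r : ℝ => r ^ 2) (𝓝 0) (𝓝 0) := by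
    simpa using (continuous_pow (M := ℝ) 2).tendsto 0
  exact h.mono_left nhdsWithin_le_nhds

/-- The Gaussian null coordinate and the square of the arc length are comparable at the horizon. -/
lemma radial_asymptotics {Q L : ℝ → ℝ} {a b : ℝ} (ha : a < 0) (hb : 0 < b)
    (hQ : ContDiffOn ℝ ∞ Q (Ioo a b)) (hQ0 : Q 0 = 0)
    (hmono : StrictMonoOn Q (Ioo a b)) (hopen : IsOpen (Q '' Ioo a b))
    (hL : ContDiffOn ℝ ∞ L (Q '' Ioo a b)) (hLQ : ∀ t ∈ Ioo a b, L (Q t) = t) :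
    HasDerivAt L (deriv Q 0)⁻¹ 0 ∧ Tendsto (fun r => L (r ^ 2)) (𝓝[>] 0) (𝓝[>] 0) ∧
      (fun r => L (r ^ 2)) =O[𝓝[>] 0] (fun r => r ^ 2) ∧
      (fun r => (L (r ^ 2))⁻¹) =O[𝓝[>] 0] (fun r => (r ^ 2)⁻¹) := by
  have h0 : (0 : ℝ) ∈ Ioo a b := ⟨ha, hb⟩
  have h0' : (0 : ℝ) ∈ Q '' Ioo a b := ⟨0, h0, hQ0⟩
  have hL0 : L 0 = 0 := by rw [← hQ0, hLQ 0 h0, hQ0]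
  have hLd : DifferentiableAt ℝ L 0 :=
    (hL.differentiableOn (by simp)).differentiableAt (hopen.mem_nhds h0')
  have hQd : DifferentiableAt ℝ Q 0 :=
    (hQ.differentiableOn (by simp)).differentiableAt (isOpen_Ioo.mem_nhds h0)
  have hev : ∀ᶠ r in 𝓝[>] (0 : ℝ), 0 < L (r ^ 2) ∧ Q (L (r ^ 2)) = r ^ 2 := by
    filter_upwards [tendsto_sq_nhdsGT.eventually (hopen.mem_nhds h0'), self_mem_nhdsWithin]
      with r hr hr0
    obtain ⟨t, ht, htr⟩ := hr
    rw [← htr, hLQ t ht]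
    refine ⟨(hmono.lt_iff_lt h0 ht).1 ?_, rfl⟩
    rw [hQ0, htr]
    exact pow_pos hr0 2
  have hLt : Tendsto (fun r => L (r ^ 2)) (𝓝[>] 0) (𝓝 0) := by
    have h := hLd.continuousAt.tendsto.comp tendsto_sq_nhdsGT
    rwa [hL0] at h
  refine ⟨?_, ?_, ?_, ?_⟩
  · have hcomp : HasDerivAt (fun t => L (Q t)) (deriv L 0 * deriv Q 0) 0 := by
      have h := hLd.hasDerivAt
      rw [← hQ0] at h
      have h' := HasDerivAt.comp 0 h hQd.hasDerivAt
      rwa [hQ0] at h'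
    have hid : HasDerivAt (fun t => L (Q t)) 1 0 :=
      (hasDerivAt_id (0 : ℝ)).congr_of_eventuallyEq (by
        filter_upwards [isOpen_Ioo.mem_nhds h0] with t ht using hLQ t ht)
    have heq := hcomp.unique hid
    rw [← eq_inv_of_mul_eq_one_left heq]
    exact hLd.hasDerivAt
  · exact tendsto_nhdsWithin_iff.2 ⟨hLt, hev.mono fun r hr => hr.1⟩
  · have h := hLd.isBigO_sub.comp_tendsto tendsto_sq_nhdsGT
    simpa [Function.comp_def, hL0] using h
  · have h := hQd.isBigO_sub.comp_tendsto hLt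
    have h' : (fun r : ℝ => r ^ 2) =O[𝓝[>] 0] fun r => L (r ^ 2) := by
      refine h.congr' ?_ (.of_forall fun r => by simp)
      filter_upwards [hev] with r hr
      simp [hQ0, hr.2]
    exact h'.inv_rev (by
      filter_upwards [self_mem_nhdsWithin] with r hr h
      exact absurd h (pow_pos hr 2).ne')

/-- The coefficient `1 / (lam Δ²)` of `ω`, with `Λ` the coordinate `lam` as a function of `ρ`. -/
lemma isBigO_inv_sub {Λ δ : ℝ → ℝ} {c : ℝ} (hΛ : Tendsto Λ (𝓝[>] 0) (𝓝[>] 0))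
    (hΛO : Λ =O[𝓝[>] 0] fun r => r ^ 2) (hΛinv : (fun r => (Λ r)⁻¹) =O[𝓝[>] 0] fun r => (r ^ 2)⁻¹)
    (hδ : DifferentiableAt ℝ δ 0) (hδ0 : 0 < δ 0) (hc : 0 < c)
    (hφ : (fun r => Λ r * δ (Λ r) - r ^ 2 * c) =O[𝓝[>] 0] fun r => r ^ 4) :
    (fun r => (Λ r * δ (Λ r) ^ 2)⁻¹ - (δ 0 * c)⁻¹ / r ^ 2) =O[𝓝[>] 0] fun _ => (1 : ℝ) := by
  have hΛ0 : Tendsto Λ (𝓝[>] 0) (𝓝 0) := hΛ.mono_right nhdsWithin_le_nhds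
  have hδt : Tendsto (fun r => δ (Λ r)) (𝓝[>] 0) (𝓝 (δ 0)) := hδ.continuousAt.tendsto.comp hΛ0
  have hδ1 : (fun r => δ (Λ r)) =O[𝓝[>] 0] fun _ => (1 : ℝ) := hδt.isBigO_one ℝ
  have hδd : (fun r => δ (Λ r) - δ 0) =O[𝓝[>] 0] fun r => r ^ 2 := by
    have h := hδ.isBigO_sub.comp_tendsto hΛ0
    simp only [Function.comp_def, sub_zero] at h
    exact h.trans hΛO
  have hnum : (fun r => r ^ 2 * c * δ 0 - Λ r * δ (Λ r) ^ 2) =O[𝓝[>] 0] fun r => r ^ 4 := by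
    have h1 := (hφ.const_mul_left (δ 0)).add
      (((hΛO.mul hδ1).mul hδd).congr_right (g₂ := fun r => r ^ 4) fun r => by ring)
    exact h1.neg_left.congr_left fun r => by ring
  have hden : (fun r => (δ (Λ r) ^ 2 * c * δ 0)⁻¹) =O[𝓝[>] 0] fun _ => (1 : ℝ) :=
    ((((hδt.pow 2).mul_const c).mul_const (δ 0)).inv₀ (by positivity)).isBigO_one ℝ
  have h := ((hnum.mul hΛinv).mul (isBigO_refl (fun r : ℝ => (r ^ 2)⁻¹) (𝓝[>] 0))).mul hden
  refine h.congr' ?_ ?_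
  · filter_upwards [hΛ.eventually self_mem_nhdsWithin, self_mem_nhdsWithin,
      hδt.eventually (isOpen_Ioi.mem_nhds hδ0)] with r h1 h2 h3
    have h1' : Λ r ≠ 0 := (mem_Ioi.1 h1).ne'
    have h2' : r ≠ 0 := (mem_Ioi.1 h2).ne'
    have h3' : δ (Λ r) ≠ 0 := (mem_Ioi.1 h3).ne'
    field_simp
  · filter_upwards [self_mem_nhdsWithin] with r hr
    have h2' : r ≠ 0 := (mem_Ioi.1 hr).ne'
    field_simp

/-! ### The cone -/

/-- The horizon data are regular on an interval around `lam = 0`, although `Δ` may vanish for some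
`lam < 0`. -/
lemma exists_Del_pos {D : GNC} {lm lp : ℝ} (hD : D.IsSmoothHorizon lm lp) (hDel : 0 < D.Del 0) :
    ∃ a, lm < a ∧ a < 0 ∧ ∀ l ∈ Ioo a lp, 0 < D.Del l := by
  have hcont : ContinuousAt D.Del 0 :=
    hD.smooth_Del.continuousOn.continuousAt (isOpen_Ioo.mem_nhds ⟨hD.lm_neg, hD.lp_pos⟩)
  obtain ⟨ε, hε, hball⟩ := Metric.eventually_nhds_iff_ball.1
    (hcont.eventually (isOpen_Ioi.mem_nhds hDel))
  obtain ⟨a, ha, ha0⟩ : ∃ a, max lm (-ε) < a ∧ a < 0 :=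
    exists_between (max_lt hD.lm_neg (by linarith))
  rw [max_lt_iff] at ha
  refine ⟨a, ha.1, ha0, fun l hl => ?_⟩
  rcases lt_or_ge 0 l with h | h
  · exact hD.Del_pos l ⟨h, hl.2⟩
  · refine hball l ?_
    rw [mem_ball_zero_iff, Real.norm_eq_abs, abs_lt]
    constructor <;> linarith [hl.1]

lemma contDiff_rot (i j : Fin 3) : ContDiff ℝ ∞ fun k => rot k i j := by
  have h : ∀ w : Fin 4, ContDiff ℝ ∞ fun k : ℍ[ℝ] => coord k w := fun w => by
    have hl : IsLinearMap ℝ fun k : ℍ[ℝ] => coord k w :=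
      ⟨fun x y => by fin_cases w <;> simp [coord], fun c x => by fin_cases w <;> simp [coord]⟩
    exact (LinearMap.toContinuousLinearMap hl.mk').contDiff
  have h0 : ContDiff ℝ ∞ fun k : ℍ[ℝ] => k.re := h 0
  have h1 : ContDiff ℝ ∞ fun k : ℍ[ℝ] => k.imI := h 1
  have h2 : ContDiff ℝ ∞ fun k : ℍ[ℝ] => k.imJ := h 2
  have h3 : ContDiff ℝ ∞ fun k : ℍ[ℝ] => k.imK := h 3
  fin_cases i <;> fin_cases j <;> simp [rot] <;> fun_prop

lemma rot_mulVec_dotProduct {k : ℍ[ℝ]} (hk : ‖k‖ = 1) (u w : Fin 3 → ℝ) :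
    (rot k *ᵥ u) ⬝ᵥ (rot k *ᵥ w) = u ⬝ᵥ w := by
  rw [Matrix.dotProduct_mulVec, ← Matrix.mulVec_transpose, Matrix.mulVec_mulVec,
    mul_eq_one_comm.1 (rot_mul_transpose hk), Matrix.one_mulVec]

lemma rot_conj_posDef {k : ℍ[ℝ]} (hk : ‖k‖ = 1) {M : Matrix (Fin 3) (Fin 3) ℝ} (hM : M.PosDef) :
    (rot k * M * (rot k)ᵀ).PosDef := by
  have h := hM.mul_mul_conjTranspose_same (B := rot k) (by
    refine Function.LeftInverse.injective (g := fun v => Matrix.vecMul v (rot k)ᵀ) fun v => ?_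
    change Matrix.vecMul (Matrix.vecMul v (rot k)) (rot k)ᵀ = v
    rw [Matrix.vecMul_vecMul, rot_mul_transpose hk, Matrix.vecMul_one])
  simpa using h

end Sugra

open Sugra in
theorem mainTheorem6 (ℓ : ℝ) (hℓ : 0 < ℓ)
    -- the spacetime near a smooth horizon, in Gaussian null coordinates
    (D : Sugra.GNC) (lm lp : ℝ) (hD : D.IsSmoothHorizon lm lp)
    -- the solution is supersymmetric, timelike outside the horizon, and SU(2)-symmetric
    (F : Sugra.Tensor2 (ℝ × ℍ[ℝ])) (f : ℍ[ℝ] → ℝ) (om : Sugra.OneForm ℍ[ℝ])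
    (h J : Sugra.Tensor2 ℍ[ℝ])
    (hsusy : Sugra.IsTimelikeSusy ℓ (Sugra.cyl (Ioo 0 lp)) D.metric F f om h J)
    (hF : Sugra.IsSU2Invariant (Ioo 0 lp) F)
    (hDel : 0 < D.Del 0) (hNH : D.nearHorizon.IsU1Invariant) :
    -- the constants fixed by the near-horizon geometry
    (D.coneMetric.PosDef ∧ D.coneMetric.IsDiag ∧ D.coneMetric 0 0 = D.coneMetric 1 1) ∧
    (∀ i, D.coneOmega i = if i = 2 then D.coneOmega 2 else 0) ∧
    0 < D.coneF ∧
    ∃ (Ψ : OpenPartialHomeomorph ℍ[ℝ] ℍ[ℝ]) (R : Set ℝ) (ρ χ : ℝ → ℝ)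
      (H : ℝ → Matrix (Fin 3) (Fin 3) ℝ) (w : ℝ → Fin 3 → ℝ) (φ : ℝ → ℝ),
      Sugra.IsHorizonCoordChange lp R Ψ ρ ∧
      -- the base metric is `dρ² + hᵢⱼ(ρ) σᵢ σⱼ` in the new coordinates
      (∀ i j, ContDiffOn ℝ ∞ (fun r => H r i j) R) ∧ (∀ r ∈ R, (H r).PosDef) ∧
      (∀ x ∈ Sugra.cyl (Ioo 0 lp), ∀ X Y,
        h x X Y = Sugra.su2Metric H (Ψ x) (fderiv ℝ Ψ x X) (fderiv ℝ Ψ x Y)) ∧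
      -- `om` is `ωᵢ(ρ) σᵢ` up to the gauge term `dχ`
      (∀ i, ContDiffOn ℝ ∞ (fun r => w r i) R) ∧ ContDiffOn ℝ ∞ χ (Ioo 0 lp) ∧
      (∀ x ∈ Sugra.cyl (Ioo 0 lp), ∀ X,
        om x X = Sugra.su2Form w (Ψ x) (fderiv ℝ Ψ x X)
          + deriv χ (Real.log ‖x‖) * Sugra.ds x X) ∧
      -- `f` is a function of `ρ`
      (∀ x ∈ Sugra.cyl (Ioo 0 lp), f x = φ (Real.log ‖Ψ x‖)) ∧
      -- the behaviour as `ρ → 0`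
      (∀ i j, (fun r => H r i j - r ^ 2 * D.coneMetric i j) =O[𝓝[>] 0] fun r => r ^ 4) ∧
      (∀ i, (fun r => w r i - D.coneOmega i / r ^ 2) =O[𝓝[>] 0] fun _ => (1 : ℝ)) ∧
      ((fun r => φ r - r ^ 2 * D.coneF) =O[𝓝[>] 0] fun r => r ^ 4) ∧
      ∃ (E : ℝ → ℝ) (ε : ℝ), 0 < ε ∧ ContDiffOn ℝ ∞ E (Ioo (-ε) ε) ∧
        ∀ᶠ r in 𝓝[>] (0 : ℝ), φ r = r ^ 2 * D.coneF + E (r ^ 2) := by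
  have hg0 : (D.gam 0).PosDef := hD.posDef_gam 0 ⟨hD.lm_neg, hD.lp_pos⟩
  have hF0 : 0 < D.coneF := D.coneF_pos hg0 hDel
  have hor0 := GNC.hor_zero_eq hNH
  refine ⟨GNC.coneMetric_props hNH hg0 hDel, fun i => ?_, hF0, ?_⟩
  · split_ifs with hi
    · rw [hi]
    · rw [GNC.coneOmega_eq, hor0]
      fin_cases i <;> simp at hi ⊢
  -- the data are regular on an interval that extends across the horizon
  obtain ⟨a, hlma, ha, hDpos⟩ := exists_Del_pos hD hDel
  have hlp := hD.lp_pos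
  have hsub : Ioo a lp ⊆ Ioo lm lp := Ioo_subset_Ioo_left hlma.le
  have hsub0 : Ioo 0 lp ⊆ Ioo a lp := Ioo_subset_Ioo_left ha.le
  have h0 : (0 : ℝ) ∈ Ioo a lp := ⟨ha, hlp⟩
  have sDel := hD.smooth_Del.mono hsub
  have sHor := fun i => (hD.smooth_hor i).mono hsub
  have sGam := fun i j => (hD.smooth_gam i j).mono hsub
  have hGpos : ∀ l ∈ Ioo a lp, (D.gam l).PosDef := fun l hl => hD.posDef_gam l (hsub hl)
  have hNpos : ∀ l ∈ Ioo a lp, 0 < D.normSq l := fun l hl =>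
    GNC.normSq_pos (hGpos l hl) (hDpos l hl)
  have sN := GNC.contDiffOn_normSq sDel sHor sGam hGpos
  have sShift := GNC.contDiffOn_shift sDel sHor sGam hGpos hDpos
  have sBase := GNC.contDiffOn_baseMat sDel sHor sGam hDpos
  -- the radial coordinate
  let q : ℝ → ℝ := fun l => √(D.Del l / D.normSq l)
  have hqpos : ∀ l ∈ Ioo a lp, 0 < q l := fun l hl =>
    Real.sqrt_pos.2 (div_pos (hDpos l hl) (hNpos l hl))
  have sq : ContDiffOn ℝ ∞ q (Ioo a lp) :=
    (sDel.div sN fun l hl => (hNpos l hl).ne').sqrt fun l hl =>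
      (div_pos (hDpos l hl) (hNpos l hl)).ne'
  obtain ⟨Q, sQ, hQd, hQ0, hQd0, hQρ⟩ := exists_radial ha hlp sq hqpos
  obtain ⟨hmono, hopen, L, sL, hLQ⟩ := exists_smooth_inverse sQ hQd
  have h0' : (0 : ℝ) ∈ Q '' Ioo a lp := ⟨0, h0, hQ0⟩
  have hL0 : L 0 = 0 := by rw [← hQ0, hLQ 0 h0, hQ0]
  obtain ⟨hLd, hΛt, hΛO, hΛinv⟩ := radial_asymptotics ha hlp sQ hQ0 hmono hopen sL hLQ
  let ρ : ℝ → ℝ := fun l => √(Q l)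
  let Λ : ℝ → ℝ := fun r => L (r ^ 2)
  let R : Set ℝ := {r | 0 < r ∧ r ^ 2 ∈ Q '' Ioo a lp}
  have hRopen : IsOpen R := isOpen_Ioi.inter (hopen.preimage (continuous_pow 2))
  have hρR : ∀ l ∈ Ioo 0 lp, ρ l ∈ R ∧ Λ (ρ l) = l := fun l hl => by
    have hQl := (hQρ l hl).1
    have h2 : ρ l ^ 2 = Q l := Real.sq_sqrt hQl.le
    refine ⟨⟨Real.sqrt_pos.2 hQl, h2 ▸ mem_image_of_mem Q (hsub0 hl)⟩, ?_⟩
    simp only [Λ]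
    rw [h2, hLQ l (hsub0 hl)]
  have hΛR : ∀ r ∈ R, Λ r ∈ Ioo 0 lp ∧ ρ (Λ r) = r := fun r hr => by
    obtain ⟨hr0, l, hl, hlr⟩ := hr
    have h1 : Λ r = l := by
      simp only [Λ]
      rw [← hlr, hLQ l hl]
    have h2 : 0 < l := (hmono.lt_iff_lt h0 hl).1 (by rw [hQ0, hlr]; positivity)
    rw [h1]
    exact ⟨⟨h2, hl.2⟩, by simp only [ρ]; rw [hlr, Real.sqrt_sq hr0.le]⟩
  have sρ : ContDiffOn ℝ ∞ ρ (Ioo 0 lp) := (sQ.mono hsub0).sqrt fun l hl => (hQρ l hl).1.ne'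
  have sΛ : ContDiffOn ℝ ∞ Λ R := sL.comp (contDiff_id.pow 2).contDiffOn fun r hr => hr.2
  have hΛa : ∀ r ∈ R, Λ r ∈ Ioo a lp := fun r hr => hsub0 (hΛR r hr).1
  have hRev : R ∈ 𝓝[>] (0 : ℝ) := by
    filter_upwards [tendsto_sq_nhdsGT.eventually (hopen.mem_nhds h0'), self_mem_nhdsWithin]
      with r hr hr0 using ⟨hr0, hr⟩
  -- the frame
  obtain ⟨h1, h2⟩ := GNC.shift_zero hNH hg0
  obtain ⟨k, sk, hk, hkn⟩ := exists_frame ha hlp sShift h1 h2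
  have hK : ∀ᶠ r in 𝓝[>] (0 : ℝ), ‖k (Λ r)‖ = 1 := by
    filter_upwards [hRev] with r hr using (hk _ (hΛR r hr).1).2
  have hKn : (fun r => k (Λ r) * e₃ * star (k (Λ r)) - e₃) =O[𝓝[>] 0] fun r => r ^ 2 :=
    (hkn.comp_tendsto hΛt).trans hΛO
  have sK : ContDiffOn ℝ ∞ (fun r => k (Λ r)) R := sk.comp sΛ fun r hr => (hΛR r hr).1
  have sRot : ∀ i j, ContDiffOn ℝ ∞ (fun r => rot (k (Λ r)) i j) R := fun i j =>
    (contDiff_rot i j).comp_contDiffOn sK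
  obtain ⟨Ψ, hsrc, htgt, hΨ, sΨ, sΨ', hrad⟩ := exists_coordChange
    (g := fun l => Real.exp (ρ l - l) • k l) isOpen_Ioo hRopen
    ((sρ.sub contDiffOn_id).exp.smul sk) sΛ hρR hΛR fun l hl => by
      rw [norm_smul, (hk l hl).2, mul_one, Real.norm_of_nonneg (Real.exp_pos _).le]
  have hΛΨ : ∀ x ∈ cyl (Ioo 0 lp), Λ (Real.log ‖Ψ x‖) = Real.log ‖x‖ := fun x hx => by
    rw [hrad x hx, (hρR _ hx.2).2]
  have hmc := fun x (hx : x ∈ cyl (Ioo 0 lp)) =>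
    maurerCartan_twist hx.1 (hQρ _ hx.2).2 (hk _ hx.2).1 (hk _ hx.2).2 hΨ
  -- the function `f`
  let φ : ℝ → ℝ := fun r => Λ r * D.Del (Λ r)
  have sΦ : ContDiffOn ℝ ∞ (fun s => L s * D.Del (L s)) (Q '' Ioo a lp) :=
    sL.mul (sDel.comp sL (by rintro _ ⟨l, hl, rfl⟩; rwa [hLQ l hl]))
  let E : ℝ → ℝ := fun s => L s * D.Del (L s) - s * D.coneF
  have sE : ContDiffOn ℝ ∞ E (Q '' Ioo a lp) := sΦ.sub (contDiffOn_id.mul contDiffOn_const)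
  have hDelD : DifferentiableAt ℝ D.Del 0 :=
    (sDel.differentiableOn (by simp)).differentiableAt (isOpen_Ioo.mem_nhds h0)
  have hE0 : E 0 = 0 := by simp [E, hL0]
  have hE1 : deriv E 0 = 0 := by
    have hd1 : HasDerivAt D.Del (deriv D.Del 0) (L 0) := by rw [hL0]; exact hDelD.hasDerivAt
    have hd2 := (hLd.mul (hd1.comp 0 hLd)).sub ((hasDerivAt_id (0 : ℝ)).mul_const D.coneF)
    refine (hd2.congr_deriv ?_).deriv
    have hN0 := hNpos 0 h0
    simp only [Function.comp_apply, hL0, hQd0, q, GNC.coneF, GNC.nhNorm_eq]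
    rw [Real.sq_sqrt (div_pos hDel hN0).le]
    field_simp
    ring
  have hφE : ∀ r, φ r = r ^ 2 * D.coneF + E (r ^ 2) := fun r => by simp only [φ, E, Λ]; ring
  have hφO : (fun r => φ r - r ^ 2 * D.coneF) =O[𝓝[>] 0] fun r => r ^ 4 := by
    have hEO := (isBigO_sq_of_deriv_eq_zero hopen h0' sE hE0 hE1).comp_tendsto tendsto_sq_nhdsGT
    refine (hEO.congr_left fun r => ?_).congr_right fun r => ?_
    · simp only [Function.comp_apply]; rw [hφE]; ring
    · simp only [Function.comp_apply]; ring
  have hφO2 : φ =O[𝓝[>] 0] fun r => r ^ 2 := by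
    have hD1 : (fun r => D.Del (Λ r)) =O[𝓝[>] 0] fun _ => (1 : ℝ) :=
      (hDelD.continuousAt.tendsto.comp (hΛt.mono_right nhdsWithin_le_nhds)).isBigO_one ℝ
    simpa using hΛO.mul hD1
  -- smooth functions of `lam` vary at order `ρ²`
  have hvar : ∀ y : ℝ → ℝ, ContDiffOn ℝ ∞ y (Ioo a lp) →
      (fun r => y (Λ r) - y 0) =O[𝓝[>] 0] fun r => r ^ 2 := fun y hy => by
    have hyd : DifferentiableAt ℝ y 0 :=
      (hy.differentiableOn (by simp)).differentiableAt (isOpen_Ioo.mem_nhds h0)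
    have hO := hyd.isBigO_sub.comp_tendsto (hΛt.mono_right nhdsWithin_le_nhds)
    simp only [Function.comp_def, sub_zero] at hO
    exact hO.trans hΛO
  -- the metric and the 1-form in the rotated frame
  let M : ℝ → Matrix (Fin 3) (Fin 3) ℝ := fun r =>
    rot (k (Λ r)) * D.baseMat (Λ r) * (rot (k (Λ r)))ᵀ
  let ζ : ℝ → ℝ := fun r => (Λ r * D.Del (Λ r) ^ 2)⁻¹
  have hφpos : ∀ r ∈ R, 0 < φ r := fun r hr =>
    mul_pos (hΛR r hr).1.1 (hDpos _ (hΛa r hr))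
  have sM : ∀ i j, ContDiffOn ℝ ∞ (fun r => M r i j) R := fun i j => by
    simp only [M, Matrix.mul_apply, Matrix.transpose_apply]
    exact ContDiffOn.sum fun m _ => (ContDiffOn.sum fun n _ =>
      (sRot i n).mul ((sBase n m).comp sΛ hΛa)).mul (sRot j m)
  have sζ : ContDiffOn ℝ ∞ ζ R := (sΛ.mul ((sDel.comp sΛ hΛa).pow 2)).inv fun r hr =>
    (mul_pos (hΛR r hr).1.1 (pow_pos (hDpos _ (hΛa r hr)) 2)).ne'
  have sφ : ContDiffOn ℝ ∞ φ R := sΛ.mul (sDel.comp sΛ hΛa)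
  obtain ⟨χ, sχ, hχ⟩ := exists_antideriv (a := 0) (b := lp)
    (u := fun l => -(l ^ 2 * D.normSq l)⁻¹)
    (((contDiffOn_id.pow 2).mul (sN.mono hsub0)).inv fun l hl =>
      (mul_pos (pow_pos hl.1 2) (hNpos l (hsub0 hl))).ne').neg
  refine ⟨Ψ, R, ρ, χ, fun r => φ r • M r, fun r => -(ζ r • (rot (k (Λ r)) *ᵥ D.hor (Λ r))), φ,
    ⟨hsrc, htgt, sΨ, sΨ', fun x _ p hp => ?_, ⟨?_, hRopen, fun r hr => hr.1, hRev⟩,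
      fun x hx => hrad x (hsrc ▸ hx), ?_⟩,
    fun i j => sφ.mul (sM i j), fun r hr => ?_, fun x hx X Y => ?_, fun i => ?_, sχ,
    fun x hx X => ?_, fun x hx => ?_, fun i j => ?_, fun i => ?_, hφO, ?_⟩
  · rw [hΨ, hΨ, norm_mul, hp, mul_one, mul_assoc]
  · refine ⟨fun r hr s hs t ht => ⟨hr.1.trans_le ht.1, ?_⟩⟩
    have hoc : (Q '' Ioo a lp).OrdConnected :=
      (isPreconnected_Ioo.image Q sQ.continuousOn).ordConnected
    have ht0 : 0 < t := hr.1.trans_le ht.1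
    exact hoc.out hr.2 hs.2 ⟨pow_le_pow_left₀ hr.1.le ht.1 2, pow_le_pow_left₀ ht0.le ht.2 2⟩
  · refine tendsto_nhdsWithin_iff.2 ⟨?_, ?_⟩
    · have hc : ContinuousAt ρ 0 :=
        (sQ.continuousOn.continuousAt (isOpen_Ioo.mem_nhds h0)).sqrt
      have hc' := hc.tendsto
      simp only [ρ, hQ0, Real.sqrt_zero] at hc'
      exact hc'.mono_left nhdsWithin_le_nhds
    · filter_upwards [Ioo_mem_nhdsGT hlp] with l hl using (hρR l hl).1.1
  · exact (rot_conj_posDef (hk _ (hΛR r hr).1).2 (GNC.baseMat_posDef (hGpos _ (hΛa r hr)))).smul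
      (hφpos r hr)
  · obtain ⟨-, -, hh⟩ := hsusy.base_eq hD.Del_pos hx rfl
    have hl := hx.2
    have hla := hsub0 hl
    have hl0 : 0 < Real.log ‖x‖ := hl.1
    have hρ' : (q (Real.log ‖x‖) / √(Real.log ‖x‖)) ^ 2
        = D.Del (Real.log ‖x‖) / (Real.log ‖x‖ * D.normSq (Real.log ‖x‖)) := by
      rw [div_pow, Real.sq_sqrt hl0.le, Real.sq_sqrt (div_pos (hDpos _ hla) (hNpos _ hla)).le,
        div_div, mul_comm]
    rw [hh, GNC.base_metric_eq (hGpos _ hla) (hDpos _ hla) hl0, su2Metric_eq, (hmc x hx X).1,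
      (hmc x hx Y).1, (hmc x hx X).2, (hmc x hx Y).2]
    simp only [φ, M, hΛΨ x hx]
    rw [Matrix.smul_mulVec, dotProduct_smul, ← Matrix.mulVec_mulVec, ← Matrix.mulVec_mulVec,
      Matrix.mulVec_mulVec (M := (rot _)ᵀ), mul_eq_one_comm.1 (rot_mul_transpose (hk _ hl).2),
      Matrix.one_mulVec, rot_mulVec_dotProduct (hk _ hl).2, smul_eq_mul, ← hρ']
    ring
  · simp only [Pi.neg_apply, Pi.smul_apply, smul_eq_mul, Matrix.mulVec]
    exact (sζ.mul (contDiffOn_dotProduct (sRot i) fun j => (sHor j).comp sΛ hΛa)).neg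
  · obtain ⟨-, ho, -⟩ := hsusy.base_eq hD.Del_pos hx rfl
    have hl := hx.2
    have hla := hsub0 hl
    have hl0 : 0 < Real.log ‖x‖ := hl.1
    have hN := hNpos _ hla
    have hd := hDpos _ hla
    rw [ho, su2Form_eq, (hmc x hx X).2, hχ _ hl]
    simp only [ζ, hΛΨ x hx]
    rw [neg_dotProduct, smul_dotProduct, rot_mulVec_dotProduct (hk _ hl).2, dotProduct_add,
      dotProduct_smul, GNC.hor_dotProduct_shift hN.ne']
    simp only [smul_eq_mul]
    field_simp
    ring
  · rw [(hsusy.base_eq hD.Del_pos hx rfl).1]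
    simp only [φ, hΛΨ x hx]
  · have hMO := isBigO_rot_conj_sub hK hKn (M := fun r => D.baseMat (Λ r))
      (GNC.baseMat_zero_eq hNH hg0) (fun i j => hvar _ (sBase i j)) i j
    have h1 := (hφO2.mul hMO).congr_right (g₂ := fun r => r ^ 4) fun r => by ring
    refine (h1.add (hφO.const_mul_left (D.baseMat 0 i j))).congr_left fun r => ?_
    rw [GNC.coneMetric_eq]
    simp only [Matrix.smul_apply, smul_eq_mul, M]
    ring
  · have hVO := isBigO_rot_mulVec_sub hK hKn hor0 (V := fun r => D.hor (Λ r))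
      (fun i => hvar _ (sHor i)) i
    have hζO := isBigO_inv_sub hΛt hΛO hΛinv hDelD hDel hF0 hφO
    have hζ2 : ζ =O[𝓝[>] 0] fun r => (r ^ 2)⁻¹ := by
      have hD1 : (fun r => (D.Del (Λ r) ^ 2)⁻¹) =O[𝓝[>] 0] fun _ => (1 : ℝ) :=
        (((hDelD.continuousAt.tendsto.comp (hΛt.mono_right nhdsWithin_le_nhds)).pow 2).inv₀
          (by positivity)).isBigO_one ℝ
      refine ((hΛinv.mul hD1).congr_left fun r => ?_).congr_right fun r => mul_one _
      simp only [ζ, Λ, mul_inv]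
    have h1 : (fun r => ζ r * ((rot (k (Λ r)) *ᵥ D.hor (Λ r)) i - D.hor 0 i))
        =O[𝓝[>] 0] fun _ => (1 : ℝ) := by
      refine (hζ2.mul hVO).congr' EventuallyEq.rfl ?_
      filter_upwards [self_mem_nhdsWithin] with r hr
      exact inv_mul_cancel₀ (pow_pos hr 2).ne'
    refine (h1.add (hζO.const_mul_left (D.hor 0 i))).neg_left.congr_left fun r => ?_
    rw [GNC.coneOmega_eq]
    simp only [Pi.neg_apply, Pi.smul_apply, smul_eq_mul, ζ]
    ring
  · obtain ⟨ε, hε, hball⟩ := Metric.isOpen_iff.1 hopen 0 h0'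
    refine ⟨E, ε, hε, sE.mono fun s hs => hball ?_, .of_forall hφE⟩
    rw [mem_ball_zero_iff, Real.norm_eq_abs, abs_lt]
    exact hs
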